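/- Let $\mathcal W_{\mathrm{un}}=\{(z,w)\in\mathbb C^2:\ |w-e^{i\log|z|^2}|^2<1,\ z\neq 0\}$, $M=\partial\mathcal W_{\mathrm{un}}$ and $p=(1,2)\in M$. Let $\mathrm{Aut}_p(M,p)$ be the set of germs at $p$ of holomorphic maps $H=(f,g):(\mathbb C^2,p)\to\mathbb C^2$ with $H(p)=p$, $\det H'(p)\neq0$ and $H(M)\subset M$ near $p$, with composition as multiplication and with the topology induced from the inductive limit topology on germs of holomorphic maps at $p$ (uniform convergence on neighbourhoods of $p$). Then $\mathrm{Aut}_p(M,p)$ is a group, and with this multiplication and this topology it is a (Hausdorff, second countable, smooth) Lie group of real dimension $5$. Moreover it is given explicitly as follows, where $s=z^i=e^{i\log z}$ and all powers are taken with the principal branch. Every $H=(f,g)\in \mathrm{Aut}_p(M,p)$ has $f_z(1,2)\ne0$. For real $\mu,\nu,\xi,\rho$: 1. If $\nu\ne0$ and $\xi+i\rho\neq0$, the germs $H\in\mathrm{Aut}_p(M,p)$ with $f_z(1,2)=\mu+i\nu$, $f_w(1,2)=\xi+i\rho$ are exactly the germs at $p$ of the maps $$H_1=\left(\Big(\frac{N_1}{D_1}\Big)^{i},\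 \frac{2D_1^2}{N_1\left(2D_1-N_1+\nu q(\mu-i\nu)(\mu^2+\nu^2)T\right)}\right),\qquad \sigma,\varphi,\psi\in\mathbb R,$$ where $q=\xi^2+\rho^2$, $T=w(2s-1)-2s^2$, $$K=\mu^2(q+\xi\sigma+\rho\varphi)-\mu\nu(\xi+i\rho)\big(\rho+\varphi+i(\xi+\sigma)\big)-(\mu-i\nu)q(2\rho+\psi)+2q^2+i\nu^2(\xi\varphi-\rho\sigma),$$ $$N_1=w\left(-\nu(\mu-i\nu)q-4i\nu q(\xi-i\rho)(s-1)-2i(2s-1)K\right)+4is^2K,$$ $$D_1=N_1-\nu q(\mu^2+\nu^2)(s-1)w-2i\nu q(\mu-i\nu)(\xi+i\rho)T.$$ 2. If $\mu\ne0$ and $\xi+i\rho\ne0$, the germs $H\in\mathrm{Aut}_p(M,p)$ with $f_z(1,2)=\mu$, $f_w(1,2)=\xi+i\rho$ are exactly the germs at $p$ of the maps $$H_2=\left(\Big(\frac{N_2}{D_2}\Big)^{i},\ \frac{2D_2^2}{N_2E_2}\right),\qquad \sigma,\varphi,\psi\in\mathbb R,$$ where $q=\xi^2+\rho^2$, $$\begin{aligned}N_2={}&w\left(\mu^2\big(2i(2s-1)(\rho\sigma-\xi\varphi)+q\big)+2\mu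 q\big(2s(\rho+i(\psi-\xi))-2\rho-i\psi\big)-4(2s-1)q^2\right)\\&+4s^2\left(i\mu^2(\xi\varphi-\rho\sigma)+i\mu q(2\xi-\psi)+2q^2\right),\end{aligned}$$ $$\begin{aligned}D_2={}&w\left(\mu^3(s-1)q+\mu^2\big(2i(2s-1)(q(\xi+i\rho)+\rho\sigma-\xi\varphi)+q\big)+2\mu q\big(2s(\rho+i(\psi-\xi))-2\rho-i\psi\big)-4(2s-1)q^2\right)\\&-4is^2\left(\mu^2\big(q(\xi+i\rho)-\xi\varphi+\rho\sigma\big)-\mu q(2\xi-\psi)+2iq^2\right),\end{aligned}$$ $$\begin{aligned}E_2={}&w\big(-\mu^4(2s-1)q+2\mu^3(s-1)q+\mu^2\big(2i(2s-1)(2q(\xi+i\rho)-\xi\varphi+\rho\sigma)+q\big)\\&\quad+2\mu q\big(2s(\rho+i(\psi-\xi))-2\rho-i\psi\big)-4(2s-1)q^2\big)\\&+2s^2\left(\mu^4q-2i\mu^2\big(2q(\xi+i\rho)-\xi\varphi+\rho\sigma\big)+2i\mu q(2\xi-\psi)+4q^2\right).\end{aligned}$$ 3. If $\nu\ne0$,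 the germs $H\in\mathrm{Aut}_p(M,p)$ with $f_z(1,2)=\mu+i\nu$, $f_w(1,2)=0$ are exactly the germs at $p$ of the maps $H_3=(f_3,g_3)$, $\psi\in\mathbb R$, with $$f_3=\left(\frac{w(4\psi s-i\nu-2\psi)-4\psi s^2}{w\big(4\psi s+\nu^2(s-1)-i\nu(1+\mu(s-1))-2\psi\big)-4\psi s^2}\right)^{i},$$ $$g_3=\frac{-2i\left(w\big(-4\psi s-\nu^2(s-1)+i\nu(1+\mu(s-1))+2\psi\big)+4\psi s^2\right)^2}{\left(w(-4\psi s+i\nu+2\psi)+4\psi s^2\right)\,G_3},$$ $$G_3=w\big(-(\mu-1)\nu(2\mu s-\mu+1)-\nu^3(2s-1)+2i\nu^2(s-1)+2i\psi(2s-1)\big)+2s^2(\mu^2\nu+\nu^3-2i\psi).$$ 4. If $\mu\neq0$, the germs $H\in\mathrm{Aut}_p(M,p)$ with $f_z(1,2)=\mu$, $f_w(1,2)=0$ are exactly the germs at $p$ of the maps $H_4=(f_4,g_4)$, $\psi\in\mathbb R$, with $$f_4=\left(\frac{w\big(2i\psi(2s-1)-\mu\big)-4i\psi s^2}{w\big(2i\psi(2s-1)-\mu^2(s-1)-\mu\big)-4i\psi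 s^2}\right)^{i},$$ $$g_4=\frac{2\left(w\big(-2i\psi(2s-1)+\mu^2(s-1)+\mu\big)+4i\psi s^2\right)^2}{\left(w\big(-2i\psi(2s-1)+\mu\big)+4i\psi s^2\right)\left(w\big(-2i\psi(2s-1)+\mu^2(-2(\mu-1)s+\mu-2)+\mu\big)+2s^2(\mu^3+2i\psi)\right)}.$$ -/

import Mathlib

open Filter Topology Complex
open scoped Manifold ContDiff UniformConvergence

/-- The unbounded worm domain
`{(z, w) : |w - e^{i log |z|²}|² < 1, z ≠ 0}` in `ℂ²`. -/
def unboundedWorm : Set (ℂ × ℂ) :=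
  {x | ‖x.2 - exp (I * (Real.log (‖x.1‖ ^ 2) : ℂ))‖ ^ 2 < 1 ∧ x.1 ≠ 0}

/-- `F` represents a local CR isotropy of `M ⊆ ℂ²` at `p`: it is holomorphic near `p`, fixes `p`,
maps `M` into `M` near `p`, and has invertible derivative at `p`. -/
structure IsLocalIsotropy (M : Set (ℂ × ℂ)) (p : ℂ × ℂ) (F : ℂ × ℂ → ℂ × ℂ) : Prop where
  analyticAt : AnalyticAt ℂ F p
  map_point : F p = p
  map_mem : ∀ᶠ x in 𝓝 p, x ∈ M → F x ∈ M
  det_ne_zero : (fderiv ℂ F p).det ≠ 0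

theorem IsLocalIsotropy.tendsto {M : Set (ℂ × ℂ)} {p : ℂ × ℂ} {F : ℂ × ℂ → ℂ × ℂ}
    (hF : IsLocalIsotropy M p F) : Tendsto F (𝓝 p) (𝓝 p) := by
  have h := hF.analyticAt.continuousAt.tendsto
  rwa [hF.map_point] at h

theorem IsLocalIsotropy.id (M : Set (ℂ × ℂ)) (p : ℂ × ℂ) :
    IsLocalIsotropy M p (fun x => x) where
  analyticAt := analyticAt_id
  map_point := rfl
  map_mem := Eventually.of_forall fun _ h => h
  det_ne_zero := by
    rw [fderiv_fun_id]
    simp [ContinuousLinearMap.det]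

theorem IsLocalIsotropy.comp {M : Set (ℂ × ℂ)} {p : ℂ × ℂ} {F G : ℂ × ℂ → ℂ × ℂ}
    (hF : IsLocalIsotropy M p F) (hG : IsLocalIsotropy M p G) :
    IsLocalIsotropy M p (F ∘ G) where
  analyticAt := by
    refine AnalyticAt.comp ?_ hG.analyticAt
    rw [hG.map_point]
    exact hF.analyticAt
  map_point := by simp [hG.map_point, hF.map_point]
  map_mem := by
    filter_upwards [hG.map_mem, hG.tendsto.eventually hF.map_mem] with x h₁ h₂ hx
    exact h₂ (h₁ hx)
  det_ne_zero := by
    have hF' : DifferentiableAt ℂ F (G p) := by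
      rw [hG.map_point]
      exact hF.analyticAt.differentiableAt
    rw [fderiv_comp p hF' hG.analyticAt.differentiableAt, hG.map_point]
    have h : ((fderiv ℂ F p).comp (fderiv ℂ G p)).det
        = (fderiv ℂ F p).det * (fderiv ℂ G p).det := LinearMap.det_comp _ _
    rw [h]
    exact mul_ne_zero hF.det_ne_zero hG.det_ne_zero

/-- Two representatives are identified when they agree near `p`. -/
instance isotropySetoid (M : Set (ℂ × ℂ)) (p : ℂ × ℂ) :
    Setoid {F : ℂ × ℂ → ℂ × ℂ // IsLocalIsotropy M p F} where
  r F G := F.1 =ᶠ[𝓝 p] G.1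
  iseqv := ⟨fun _ => EventuallyEq.rfl, fun h => h.symm, fun h h' => h.trans h'⟩

/-- The germs at `p` of local CR isotropies of `M` at `p`. -/
def IsotropyGerms (M : Set (ℂ × ℂ)) (p : ℂ × ℂ) : Type :=
  Quotient (isotropySetoid M p)

/-- Composition of germs. That every germ is invertible is not built in. -/
instance IsotropyGerms.instMonoid (M : Set (ℂ × ℂ)) (p : ℂ × ℂ) :
    Monoid (IsotropyGerms M p) where
  mul := Quotient.map₂ (fun F G => ⟨F.1 ∘ G.1, F.2.comp G.2⟩) (by
    intro F F' hF G G' hG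
    change F.1 ∘ G.1 =ᶠ[𝓝 p] F'.1 ∘ G'.1
    have hF' : F.1 =ᶠ[𝓝 p] F'.1 := hF
    have hG' : G.1 =ᶠ[𝓝 p] G'.1 := hG
    filter_upwards [hG', G.2.tendsto.eventually hF'] with x h₁ h₂
    simp only [Function.comp_apply, ← h₁, h₂])
  one := Quotient.mk _ ⟨fun x => x, IsLocalIsotropy.id M p⟩
  mul_assoc := by
    rintro ⟨F⟩ ⟨G⟩ ⟨H⟩
    rfl
  one_mul := by
    rintro ⟨F⟩
    rfl
  mul_one := by
    rintro ⟨F⟩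
    rfl

/-- The maps holomorphic on (a neighbourhood of) the closed polydisc of radius `r` about `p`, with
the topology of uniform convergence on that polydisc. -/
def HolOn (p : ℂ × ℂ) (r : ℝ) : Type :=
  {F : (ℂ × ℂ) →ᵤ[{Metric.closedBall p r}] (ℂ × ℂ) //
    AnalyticOnNhd ℂ (UniformOnFun.toFun {Metric.closedBall p r} F) (Metric.closedBall p r)}

instance HolOn.instTopologicalSpace (p : ℂ × ℂ) (r : ℝ) : TopologicalSpace (HolOn p r) :=
  inferInstanceAs (TopologicalSpace {F : (ℂ × ℂ) →ᵤ[{Metric.closedBall p r}] (ℂ × ℂ) //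
    AnalyticOnNhd ℂ (UniformOnFun.toFun {Metric.closedBall p r} F) (Metric.closedBall p r)})

/-- The germ at `p` of a map holomorphic on a polydisc about `p`. -/
noncomputable def HolOn.germ {p : ℂ × ℂ} {r : ℝ} (F : HolOn p r) : (𝓝 p).Germ (ℂ × ℂ) :=
  ((UniformOnFun.toFun {Metric.closedBall p r} F.1 : ℂ × ℂ → ℂ × ℂ) : (𝓝 p).Germ (ℂ × ℂ))

/-- The inductive limit topology on germs of holomorphic maps: the finest topology for which all
the maps `HolOn p r → germs at p`, `r > 0`, are continuous. -/
noncomputable abbrev holGermTopology (p : ℂ × ℂ) : TopologicalSpace ((𝓝 p).Germ (ℂ × ℂ)) :=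
  ⨆ r : {r : ℝ // 0 < r},
    TopologicalSpace.coinduced (HolOn.germ (p := p) (r := r.1)) inferInstance

/-- The inclusion of the isotropy germs into all germs. -/
noncomputable def IsotropyGerms.toGerm {M : Set (ℂ × ℂ)} {p : ℂ × ℂ} :
    IsotropyGerms M p → (𝓝 p).Germ (ℂ × ℂ) :=
  Quotient.lift (fun F => ((F.1 : ℂ × ℂ → ℂ × ℂ) : (𝓝 p).Germ (ℂ × ℂ)))
    (fun _ _ h => Germ.coe_eq.2 h)

/-- The isotropy germs carry the subspace topology of the inductive limit topology (uniform
convergence on neighbourhoods of `p`). -/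
noncomputable instance IsotropyGerms.instTopologicalSpace (M : Set (ℂ × ℂ)) (p : ℂ × ℂ) :
    TopologicalSpace (IsotropyGerms M p) :=
  TopologicalSpace.induced IsotropyGerms.toGerm (holGermTopology p)

/-- `G`, with its given multiplication and topology, is a (Hausdorff, second countable, smooth)
real Lie group of dimension `n`. -/
def IsRealLieGroupOfDim (G : Type) [mG : Monoid G] [TopologicalSpace G] (n : ℕ) : Prop :=
  T2Space G ∧ SecondCountableTopology G ∧
    ∃ (grp : Group G) (_ : ChartedSpace (EuclideanSpace ℝ (Fin n)) G),
      grp.toDivInvMonoid.toMonoid = mG ∧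
        LieGroup 𝓘(ℝ, EuclideanSpace ℝ (Fin n)) ∞ G

/-- The derivative `f_z(1,2)` of the first component of `F = (f, g)`. -/
noncomputable def dfz (F : ℂ × ℂ → ℂ × ℂ) : ℂ := deriv (fun z => (F (z, 2)).1) 1

/-- The derivative `f_w(1,2)` of the first component of `F = (f, g)`. -/
noncomputable def dfw (F : ℂ × ℂ → ℂ × ℂ) : ℂ := deriv (fun w => (F (1, w)).1) 2

/-! In the four families below `s` stands for `z ^ i`, with the principal branch. -/

/-- The quantity `K` in the first family. -/
noncomputable def K₁ (μ ν ξ ρ σ φ ψ : ℝ) : ℂ :=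
  μ ^ 2 * (ξ ^ 2 + ρ ^ 2 + ξ * σ + ρ * φ) - μ * ν * (ξ + I * ρ) * (ρ + φ + I * (ξ + σ))
    - (μ - I * ν) * (ξ ^ 2 + ρ ^ 2) * (2 * ρ + ψ) + 2 * (ξ ^ 2 + ρ ^ 2) ^ 2
    + I * ν ^ 2 * (ξ * φ - ρ * σ)

/-- `N₁`: numerator of the base of `f₁`. -/
noncomputable def N₁ (μ ν ξ ρ σ φ ψ : ℝ) (s w : ℂ) : ℂ :=
  w * (-(ν * (μ - I * ν) * (ξ ^ 2 + ρ ^ 2)) - 4 * I * ν * (ξ ^ 2 + ρ ^ 2) * (ξ - I * ρ) * (s - 1)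
      - 2 * I * (2 * s - 1) * K₁ μ ν ξ ρ σ φ ψ)
    + 4 * I * s ^ 2 * K₁ μ ν ξ ρ σ φ ψ

/-- `D₁`: denominator of the base of `f₁`. -/
noncomputable def D₁ (μ ν ξ ρ σ φ ψ : ℝ) (s w : ℂ) : ℂ :=
  N₁ μ ν ξ ρ σ φ ψ s w
    - ν * (ξ ^ 2 + ρ ^ 2) * (μ ^ 2 + ν ^ 2) * (s - 1) * w
    - 2 * I * ν * (ξ ^ 2 + ρ ^ 2) * (μ - I * ν) * (ξ + I * ρ) * (w * (2 * s - 1) - 2 * s ^ 2)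

/-- The first family. -/
noncomputable def H₁ (μ ν ξ ρ σ φ ψ : ℝ) (x : ℂ × ℂ) : ℂ × ℂ :=
  let s : ℂ := x.1 ^ I
  let w : ℂ := x.2
  let N : ℂ := N₁ μ ν ξ ρ σ φ ψ s w
  let D : ℂ := D₁ μ ν ξ ρ σ φ ψ s w
  ((N / D) ^ I,
    2 * D ^ 2 / (N * (2 * D - N
      + ν * (ξ ^ 2 + ρ ^ 2) * (μ - I * ν) * (μ ^ 2 + ν ^ 2) * (w * (2 * s - 1) - 2 * s ^ 2))))

/-- `N₂`: numerator of the base of `f₂`. -/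
noncomputable def N₂ (μ ξ ρ σ φ ψ : ℝ) (s w : ℂ) : ℂ :=
  w * (μ ^ 2 * (2 * I * (2 * s - 1) * (ρ * σ - ξ * φ) + ξ ^ 2 + ρ ^ 2)
      + 2 * μ * (ξ ^ 2 + ρ ^ 2) * (2 * s * (ρ + I * (ψ - ξ)) - 2 * ρ - I * ψ)
      - 4 * (2 * s - 1) * (ξ ^ 2 + ρ ^ 2) ^ 2)
    + 4 * s ^ 2 * (I * μ ^ 2 * (ξ * φ - ρ * σ) + I * μ * (ξ ^ 2 + ρ ^ 2) * (2 * ξ - ψ)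
      + 2 * (ξ ^ 2 + ρ ^ 2) ^ 2)

/-- `D₂`: denominator of the base of `f₂`. -/
noncomputable def D₂ (μ ξ ρ σ φ ψ : ℝ) (s w : ℂ) : ℂ :=
  w * (μ ^ 3 * (s - 1) * (ξ ^ 2 + ρ ^ 2)
      + μ ^ 2 * (2 * I * (2 * s - 1) * ((ξ ^ 2 + ρ ^ 2) * (ξ + I * ρ) + ρ * σ - ξ * φ)
        + ξ ^ 2 + ρ ^ 2)
      + 2 * μ * (ξ ^ 2 + ρ ^ 2) * (2 * s * (-(I * ξ) + ρ + I * ψ) - 2 * ρ - I * ψ)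
      - 4 * (2 * s - 1) * (ξ ^ 2 + ρ ^ 2) ^ 2)
    - 4 * I * s ^ 2 * (μ ^ 2 * ((ξ ^ 2 + ρ ^ 2) * (ξ + I * ρ) - ξ * φ + ρ * σ)
      - μ * (ξ ^ 2 + ρ ^ 2) * (2 * ξ - ψ) + 2 * I * (ξ ^ 2 + ρ ^ 2) ^ 2)

/-- `E₂`: second factor of the denominator of `g₂`. -/
noncomputable def E₂ (μ ξ ρ σ φ ψ : ℝ) (s w : ℂ) : ℂ :=
  w * (-(μ ^ 4 * (2 * s - 1) * (ξ ^ 2 + ρ ^ 2))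
      + 2 * μ ^ 3 * (s - 1) * (ξ ^ 2 + ρ ^ 2)
      + μ ^ 2 * (2 * I * (2 * s - 1) * (2 * (ξ ^ 2 + ρ ^ 2) * (ξ + I * ρ) - ξ * φ + ρ * σ)
        + ξ ^ 2 + ρ ^ 2)
      + 2 * μ * (ξ ^ 2 + ρ ^ 2) * (2 * s * (ρ + I * (ψ - ξ)) - 2 * ρ - I * ψ)
      - 4 * (2 * s - 1) * (ξ ^ 2 + ρ ^ 2) ^ 2)
    + 2 * s ^ 2 * (μ ^ 4 * (ξ ^ 2 + ρ ^ 2)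
      - 2 * I * μ ^ 2 * (2 * (ξ ^ 2 + ρ ^ 2) * (ξ + I * ρ) - ξ * φ + ρ * σ)
      + 2 * I * μ * (ξ ^ 2 + ρ ^ 2) * (2 * ξ - ψ) + 4 * (ξ ^ 2 + ρ ^ 2) ^ 2)

/-- The second family. -/
noncomputable def H₂ (μ ξ ρ σ φ ψ : ℝ) (x : ℂ × ℂ) : ℂ × ℂ :=
  let s : ℂ := x.1 ^ I
  let w : ℂ := x.2
  ((N₂ μ ξ ρ σ φ ψ s w / D₂ μ ξ ρ σ φ ψ s w) ^ I,
    2 * D₂ μ ξ ρ σ φ ψ s w ^ 2 / (N₂ μ ξ ρ σ φ ψ s w * E₂ μ ξ ρ σ φ ψ s w))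

/-- The third family. -/
noncomputable def H₃ (μ ν ψ : ℝ) (x : ℂ × ℂ) : ℂ × ℂ :=
  let s : ℂ := x.1 ^ I
  let w : ℂ := x.2
  (((w * (4 * ψ * s - I * ν - 2 * ψ) - 4 * ψ * s ^ 2) /
      (w * (4 * ψ * s + ν ^ 2 * (s - 1) - I * ν * (1 + μ * (s - 1)) - 2 * ψ)
        - 4 * ψ * s ^ 2)) ^ I,
    -((2 * I * (w * (-(4 * ψ * s) - ν ^ 2 * (s - 1) + I * ν * (1 + μ * (s - 1)) + 2 * ψ)
          + 4 * ψ * s ^ 2) ^ 2) /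
      ((w * (-(4 * ψ * s) + I * ν + 2 * ψ) + 4 * ψ * s ^ 2) *
        (w * (-((μ - 1) * ν * (2 * μ * s - μ + 1)) - ν ^ 3 * (2 * s - 1)
            + 2 * I * ν ^ 2 * (s - 1) + 2 * I * ψ * (2 * s - 1))
          + 2 * s ^ 2 * (μ ^ 2 * ν + ν ^ 3 - 2 * I * ψ)))))

/-- The fourth family. -/
noncomputable def H₄ (μ ψ : ℝ) (x : ℂ × ℂ) : ℂ × ℂ :=
  let s : ℂ := x.1 ^ I
  let w : ℂ := x.2
  (((w * (2 * I * ψ * (2 * s - 1) - μ) - 4 * I * ψ * s ^ 2) /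
      (w * (2 * I * ψ * (2 * s - 1) - μ ^ 2 * (s - 1) - μ) - 4 * I * ψ * s ^ 2)) ^ I,
    (2 * (w * (-(2 * I * ψ * (2 * s - 1)) + μ ^ 2 * (s - 1) + μ) + 4 * I * ψ * s ^ 2) ^ 2) /
      ((w * (-(2 * I * ψ * (2 * s - 1)) + μ) + 4 * I * ψ * s ^ 2) *
        (w * (-(2 * I * ψ * (2 * s - 1)) + μ ^ 2 * (-(2 * (μ - 1) * s) + μ - 2) + μ)
          + 2 * s ^ 2 * (μ ^ 3 + 2 * I * ψ))))

/-! The function s = z^i straightens the worm. Near p one has e^{i log|z|²} = s / s̄, so the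
boundary equation reads |w|² = w s̄/s + w̄ s/s̄, that is 2 Re(s²/w) = |s|². Moving the point (s,
s²/w) = (1, 1/2) to the origin by a Heisenberg translation gives the coordinates Z = s - 1, V = s²/w
- s + 1/2 of `wormChart`, in which M is 2 Re V = |Z|². Conjugation by this chart turns isotropies of
(M, p) into isotropies of the Heisenberg hypersurface at 0.

Those isotropies are exactly the maps (Z, V) ↦ (l(Z + aV), |l|²V) / (1 + āZ + (|a|²/2 + ir)V) with l
≠ 0, a ∈ ℂ, r ∈ ℝ (`IsLocalIsotropy.eq_heisMap`). The proof uses Segre varieties. Complexifying F(M)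
⊂ M gives an identity in three free complex variables (`heisenberg_polarize`). It shows that complex
lines through 0 go into complex lines through 0, first for lines V = αZ with α small and then, by
the identity theorem, for the line Z = 0. Composing with a member of the family makes F preserve Z =
0. The identity then forces F = (Zφ(V), γ(V)) with γ(V) - γ(y) = φ(V) φ*(-y) (V - y), whose
solutions have 1/φ affine (`eq_fractional_of_functional_equation`).

Carried back to the worm, the family becomes `wormMap l a r`, with f_z = l and f_w = i l a / 4.
Fixing these two derivatives therefore leaves only r free. Each displayed family is `wormMap` with
numerators and denominators multiplied by a common constant, and its real parameters enter only
through r, which takes all real values.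

For the topology, (l, a, r) is recovered continuously from the jet (f_z, f_w, g_ww), because
derivatives are continuous for uniform convergence of holomorphic maps. Conversely, the germ of
`wormMap l a r` depends continuously on the parameters. Hence the germs are homeomorphic to the open
set l ≠ 0 of ℂ × ℂ × ℝ, of real dimension 5. Composition is polynomial in the real coordinates and
inversion is rational, so both are smooth. -/

open scoped ComplexConjugate

/-! ### Holomorphic functions vanishing at real points -/

/-- A function holomorphic on a disc about the origin and zero at the real points vanishes. -/
theorem eq_zero_of_real_zero {h : ℂ → ℂ} {ρ : ℝ} (hρ : 0 < ρ)
    (hd : ∀ z : ℂ, ‖z‖ < ρ → DifferentiableAt ℂ h z)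
    (h0 : ∀ x : ℝ, ‖(x : ℂ)‖ < ρ → h x = 0) {z : ℂ} (hz : ‖z‖ < ρ) : h z = 0 := by
  have han : AnalyticOnNhd ℂ h (Metric.ball 0 ρ) := by
    apply DifferentiableOn.analyticOnNhd _ Metric.isOpen_ball
    intro z hz
    exact (hd z (by simpa using hz)).differentiableWithinAt
  refine han.eqOn_zero_of_preconnected_of_frequently_eq_zero
    (convex_ball (0 : ℂ) ρ).isPreconnected (Metric.mem_ball_self hρ) ?_ (by simpa using hz)
  have ht : Tendsto (fun x : ℝ => (x : ℂ)) (𝓝[≠] 0) (𝓝[≠] 0) := by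
    refine tendsto_nhdsWithin_iff.2 ⟨?_, ?_⟩
    · exact (Complex.continuous_ofReal.tendsto' 0 0 (by simp)).mono_left nhdsWithin_le_nhds
    · filter_upwards [self_mem_nhdsWithin] with x hx
      simpa using hx
  refine ht.frequently (Eventually.frequently ?_)
  have : ∀ᶠ x : ℝ in 𝓝 0, ‖(x : ℂ)‖ < ρ := by
    have hc : Continuous fun x : ℝ => ‖(x : ℂ)‖ := by fun_prop
    exact hc.continuousAt.eventually_lt continuousAt_const (by simpa using hρ)
  filter_upwards [this.filter_mono nhdsWithin_le_nhds] with x hx using h0 x hx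

/-- A separately holomorphic function of three variables which vanishes at the real points
vanishes. -/
theorem eq_zero_of_real_zero₃ {h : ℂ → ℂ → ℂ → ℂ} {ρ : ℝ} (hρ : 0 < ρ)
    (hx : ∀ x y t : ℂ, ‖x‖ < ρ → ‖y‖ < ρ → ‖t‖ < ρ → DifferentiableAt ℂ (fun x => h x y t) x)
    (hy : ∀ x y t : ℂ, ‖x‖ < ρ → ‖y‖ < ρ → ‖t‖ < ρ → DifferentiableAt ℂ (fun y => h x y t) y)
    (ht : ∀ x y t : ℂ, ‖x‖ < ρ → ‖y‖ < ρ → ‖t‖ < ρ → DifferentiableAt ℂ (fun t => h x y t) t)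
    (h0 : ∀ x y t : ℝ, ‖(x : ℂ)‖ < ρ → ‖(y : ℂ)‖ < ρ → ‖(t : ℂ)‖ < ρ → h x y t = 0)
    {x y t : ℂ} (hx' : ‖x‖ < ρ) (hy' : ‖y‖ < ρ) (ht' : ‖t‖ < ρ) : h x y t = 0 := by
  have h1 : ∀ (x : ℂ) (y t : ℝ), ‖x‖ < ρ → ‖(y : ℂ)‖ < ρ → ‖(t : ℂ)‖ < ρ → h x y t = 0 :=
    fun x y t a b c => eq_zero_of_real_zero (h := fun x => h x y t) hρ
      (fun x hx₀ => hx x y t hx₀ b c) (fun x hx₀ => h0 x y t hx₀ b c) a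
  have h2 : ∀ (x y : ℂ) (t : ℝ), ‖x‖ < ρ → ‖y‖ < ρ → ‖(t : ℂ)‖ < ρ → h x y t = 0 :=
    fun x y t a b c => eq_zero_of_real_zero (h := fun y => h x y t) hρ
      (fun y hy₀ => hy x y t a hy₀ c) (fun y hy₀ => h1 x y t a hy₀ c) b
  exact eq_zero_of_real_zero (h := fun t => h x y t) hρ
      (fun t ht₀ => ht x y t hx' hy' ht₀) (fun t ht₀ => h2 x y t hx' hy' ht₀) ht'

/-! ### The Heisenberg hypersurface -/

/-- The Heisenberg hypersurface `2 Re V = |Z|²` in `ℂ²`. -/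
def heisenberg : Set (ℂ × ℂ) := {y | y.2 + conj y.2 = y.1 * conj y.1}

/-- The conjugate `f*` of a holomorphic function. -/
noncomputable def conjFun (f : ℂ × ℂ → ℂ) (x : ℂ × ℂ) : ℂ := conj (f (conj x.1, conj x.2))

theorem conjFun_differentiableAt {f : ℂ × ℂ → ℂ} {x : ℂ × ℂ}
    (hf : DifferentiableAt ℂ f (conj x.1, conj x.2)) : DifferentiableAt ℂ (conjFun f) x := by
  have h := hf.star_star
  have hx : (star ((conj x.1, conj x.2) : ℂ × ℂ)) = x := by
    ext <;> simp [Prod.fst_star, Prod.snd_star]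
  rw [hx] at h
  exact h

/-- The polarised identity satisfied by a self-map of the Heisenberg hypersurface. -/
theorem heisenberg_polarize {F : ℂ × ℂ → ℂ × ℂ} (hF : AnalyticAt ℂ F 0)
    (hQ : ∀ᶠ x in 𝓝 (0 : ℂ × ℂ), x ∈ heisenberg → F x ∈ heisenberg) :
    ∃ R > 0, (∀ x : ℂ × ℂ, ‖x‖ < R → AnalyticAt ℂ F x) ∧
      ∀ Z V ζ : ℂ, ‖Z‖ < R → ‖V‖ < R → ‖ζ‖ < R →
        (F (Z, V)).2 + conjFun (fun x => (F x).2) (ζ, Z * ζ - V) =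
          (F (Z, V)).1 * conjFun (fun x => (F x).1) (ζ, Z * ζ - V) := by
  obtain ⟨r, hr, hball⟩ := Metric.eventually_nhds_iff.1 (hF.eventually_analyticAt.and hQ)
  simp only [dist_zero_right] at hball
  set r' : ℝ := min r 1 with hr'
  have hr'0 : 0 < r' := lt_min hr one_pos
  -- Since ρ < 1, the quadratic term is at most ρ² < ρ. So both complexified points stay in the ball
  -- of radius r on which F is controlled.
  set ρ : ℝ := r' / 4 with hρ
  have hρ0 : 0 < ρ := by positivity
  have hρ1 : ρ ≤ 1 / 4 := by
    have : r' ≤ 1 := min_le_right _ _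
    linarith
  have hρr : 4 * ρ ≤ r := by
    have : r' ≤ r := min_le_left _ _
    linarith
  -- the real parametrisation, complexified
  let A : ℂ → ℂ → ℂ → ℂ × ℂ := fun x y t => (x + I * y, (x ^ 2 + y ^ 2) / 2 + I * t)
  let B : ℂ → ℂ → ℂ → ℂ × ℂ := fun x y t => (x - I * y, (x ^ 2 + y ^ 2) / 2 - I * t)
  let h : ℂ → ℂ → ℂ → ℂ := fun x y t =>
    (F (A x y t)).2 + conjFun (fun x => (F x).2) (B x y t)
      - (F (A x y t)).1 * conjFun (fun x => (F x).1) (B x y t)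
  have hsq : ∀ x y t : ℂ, ‖x‖ < ρ → ‖y‖ < ρ → ‖t‖ < ρ →
      ‖(x ^ 2 + y ^ 2) / 2‖ + ‖I * t‖ < r := by
    intro x y t hx hy ht
    have h1 : ‖(x ^ 2 + y ^ 2) / 2‖ ≤ (‖x‖ ^ 2 + ‖y‖ ^ 2) / 2 := by
      rw [norm_div, Complex.norm_ofNat, ← norm_pow, ← norm_pow]
      gcongr
      exact norm_add_le _ _
    have h2 : ‖I * t‖ = ‖t‖ := by simp
    nlinarith [norm_nonneg x, norm_nonneg y]
  have hA : ∀ x y t : ℂ, ‖x‖ < ρ → ‖y‖ < ρ → ‖t‖ < ρ → ‖A x y t‖ < r := by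
    intro x y t hx hy ht
    refine max_lt ?_ ?_
    · refine (norm_add_le _ _).trans_lt ?_
      simp only [norm_mul, norm_I, one_mul]
      linarith
    · exact (norm_add_le _ _).trans_lt (hsq x y t hx hy ht)
  have hB : ∀ x y t : ℂ, ‖x‖ < ρ → ‖y‖ < ρ → ‖t‖ < ρ →
      ‖((conj (B x y t).1, conj (B x y t).2) : ℂ × ℂ)‖ < r := by
    intro x y t hx hy ht
    refine max_lt ?_ ?_
    · simp only [RCLike.norm_conj]
      refine (norm_sub_le _ _).trans_lt ?_
      simp only [norm_mul, norm_I, one_mul]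
      linarith
    · simp only [RCLike.norm_conj]
      exact (norm_sub_le _ _).trans_lt (hsq x y t hx hy ht)
  have hFd : ∀ x : ℂ × ℂ, ‖x‖ < r → DifferentiableAt ℂ F x :=
    fun x hx => (hball hx).1.differentiableAt
  have hdiff : ∀ {a b : ℂ → ℂ × ℂ} {u : ℂ}, DifferentiableAt ℂ a u → DifferentiableAt ℂ b u →
      ‖a u‖ < r → ‖((conj (b u).1, conj (b u).2) : ℂ × ℂ)‖ < r →
      DifferentiableAt ℂ (fun u => (F (a u)).2 + conjFun (fun x => (F x).2) (b u)
        - (F (a u)).1 * conjFun (fun x => (F x).1) (b u)) u := by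
    intro a b u ha hb hau hbu
    have e1 : DifferentiableAt ℂ (fun u => F (a u)) u := (hFd _ hau).comp u ha
    have e2 : DifferentiableAt ℂ (fun u => conjFun (fun x => (F x).1) (b u)) u :=
      (conjFun_differentiableAt (f := fun x => (F x).1) (hFd _ hbu).fst).comp u hb
    have e3 : DifferentiableAt ℂ (fun u => conjFun (fun x => (F x).2) (b u)) u :=
      (conjFun_differentiableAt (f := fun x => (F x).2) (hFd _ hbu).snd).comp u hb
    exact (e1.snd.add e3).sub (e1.fst.mul e2)
  have key : ∀ x y t : ℂ, ‖x‖ < ρ → ‖y‖ < ρ → ‖t‖ < ρ → h x y t = 0 := by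
    intro x y t hx hy ht
    refine eq_zero_of_real_zero₃ hρ0 (h := h) ?_ ?_ ?_ ?_ hx hy ht
    · intro x y t hx hy ht
      exact hdiff (by fun_prop) (by fun_prop) (hA x y t hx hy ht) (hB x y t hx hy ht)
    · intro x y t hx hy ht
      exact hdiff (by fun_prop) (by fun_prop) (hA x y t hx hy ht) (hB x y t hx hy ht)
    · intro x y t hx hy ht
      exact hdiff (by fun_prop) (by fun_prop) (hA x y t hx hy ht) (hB x y t hx hy ht)
    · intro x y t hx hy ht
      have hAB : ((conj (B x y t).1, conj (B x y t).2) : ℂ × ℂ) = A x y t := by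
        simp only [A, B, map_sub, map_mul, map_add, map_pow, conj_ofReal, conj_I, map_div₀,
          map_ofNat]
        ext <;> simp
      have hmem : A x y t ∈ heisenberg := by
        simp only [heisenberg, A, Set.mem_ofPred_eq, map_mul, map_add, map_pow, conj_ofReal,
          conj_I, map_div₀, map_ofNat]
        linear_combination ((y : ℂ) ^ 2) * I_sq
      have := (hball (hA x y t hx hy ht)).2 hmem
      simp only [h, conjFun, hAB]
      rw [sub_eq_zero]
      exact this
  refine ⟨ρ / 2, by positivity, fun x hx => (hball (by linarith)).1, fun Z V ζ hZ hV hζ => ?_⟩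
  have h2I : (2 * I : ℂ) ≠ 0 := by simp
  -- The complexified parametrisation is inverted by x + iy = Z, x - iy = ζ. Then x² + y² = Zζ, and
  -- the two points become (Z, V) and (ζ, Zζ - V).
  have hx : ‖(Z + ζ) / 2‖ < ρ := by
    rw [norm_div, Complex.norm_ofNat]
    linarith [norm_add_le Z ζ]
  have hy : ‖(Z - ζ) / (2 * I)‖ < ρ := by
    rw [norm_div, norm_mul, Complex.norm_ofNat, norm_I]
    linarith [norm_sub_le Z ζ]
  have ht : ‖(V - Z * ζ / 2) / I‖ < ρ := by
    rw [norm_div, norm_I, div_one]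
    refine (norm_sub_le _ _).trans_lt ?_
    rw [norm_div, norm_mul, Complex.norm_ofNat]
    nlinarith [norm_nonneg Z, norm_nonneg ζ]
  have hk := key _ _ _ hx hy ht
  have hAe : A ((Z + ζ) / 2) ((Z - ζ) / (2 * I)) ((V - Z * ζ / 2) / I) = (Z, V) := by
    simp only [A]
    ext
    · field_simp; ring
    · field_simp; simp only [I_sq]; ring
  have hBe : B ((Z + ζ) / 2) ((Z - ζ) / (2 * I)) ((V - Z * ζ / 2) / I) = (ζ, Z * ζ - V) := by
    simp only [B]
    ext
    · field_simp; ring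
    · field_simp; simp only [I_sq]; ring
  simp only [h, hAe, hBe] at hk
  exact sub_eq_zero.1 hk

/-! ### Determinants of derivatives -/

theorem det_prod_complex (L : ℂ × ℂ →L[ℂ] ℂ × ℂ) :
    L.det = (L (1, 0)).1 * (L (0, 1)).2 - (L (0, 1)).1 * (L (1, 0)).2 := by
  rw [ContinuousLinearMap.det, ← LinearMap.det_toMatrix (Module.Basis.finTwoProd ℂ),
    Matrix.det_fin_two]
  simp [LinearMap.toMatrix_apply]

theorem det_fderiv_comp {F G : ℂ × ℂ → ℂ × ℂ} {x : ℂ × ℂ} (hF : DifferentiableAt ℂ F (G x))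
    (hG : DifferentiableAt ℂ G x) :
    (fderiv ℂ (F ∘ G) x).det = (fderiv ℂ F (G x)).det * (fderiv ℂ G x).det := by
  rw [fderiv_comp x hF hG]
  exact LinearMap.det_comp _ _

theorem det_fderiv_ne_zero_of_comp_eq_id {F G : ℂ × ℂ → ℂ × ℂ} {x : ℂ × ℂ}
    (hF : DifferentiableAt ℂ F (G x)) (hG : DifferentiableAt ℂ G x)
    (h : ∀ᶠ y in 𝓝 x, F (G y) = y) :
    (fderiv ℂ F (G x)).det ≠ 0 ∧ (fderiv ℂ G x).det ≠ 0 := by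
  have h1 : F ∘ G =ᶠ[𝓝 x] id := h
  have h2 := det_fderiv_comp hF hG
  rw [h1.fderiv_eq, fderiv_id] at h2
  have h3 : (ContinuousLinearMap.id ℂ (ℂ × ℂ)).det = 1 := by simp [ContinuousLinearMap.det]
  rw [h3] at h2
  constructor
  · rintro h; simp [h] at h2
  · rintro h; simp [h] at h2

/-! ### The linear fractional isotropies of the Heisenberg hypersurface -/

/-- The denominator of `heisMap`. -/
noncomputable def heisDenom (a : ℂ) (r : ℝ) (y : ℂ × ℂ) : ℂ :=
  1 + conj a * y.1 + (a * conj a / 2 + I * r) * y.2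

/-- The linear fractional isotropies of the Heisenberg hypersurface at the origin. -/
noncomputable def heisMap (l a : ℂ) (r : ℝ) (y : ℂ × ℂ) : ℂ × ℂ :=
  (l * (y.1 + a * y.2) / heisDenom a r y, l * conj l * y.2 / heisDenom a r y)

theorem heisMap_zero (l a : ℂ) (r : ℝ) : heisMap l a r 0 = 0 := by
  simp [heisMap]

theorem heisDenom_analyticAt (a : ℂ) (r : ℝ) (y : ℂ × ℂ) : AnalyticAt ℂ (heisDenom a r) y := by
  exact (analyticAt_const.add (analyticAt_const.mul analyticAt_fst)).add
    (analyticAt_const.mul analyticAt_snd)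

theorem heisMap_analyticAt {l a : ℂ} {r : ℝ} {y : ℂ × ℂ} (hy : heisDenom a r y ≠ 0) :
    AnalyticAt ℂ (heisMap l a r) y := by
  refine AnalyticAt.prod ?_ ?_
  · exact (analyticAt_const.mul (analyticAt_fst.add (analyticAt_const.mul analyticAt_snd))).div
      (heisDenom_analyticAt a r y) hy
  · exact (analyticAt_const.mul analyticAt_snd).div (heisDenom_analyticAt a r y) hy

theorem heisDenom_eventually_ne (a : ℂ) (r : ℝ) : ∀ᶠ y in 𝓝 0, heisDenom a r y ≠ 0 :=
  (heisDenom_analyticAt a r 0).continuousAt.eventually_ne (by simp [heisDenom])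

theorem heisMap_analyticAt_zero (l a : ℂ) (r : ℝ) : AnalyticAt ℂ (heisMap l a r) 0 :=
  heisMap_analyticAt (heisDenom_eventually_ne a r).self_of_nhds

theorem heisMap_tendsto (l a : ℂ) (r : ℝ) : Tendsto (heisMap l a r) (𝓝 0) (𝓝 0) := by
  have := (heisMap_analyticAt_zero l a r).continuousAt.tendsto
  rwa [heisMap_zero] at this

/-- The last parameter of the composition of two linear fractional isotropies. -/
noncomputable def mulR (l₁ a₁ a₂ : ℂ) (r₁ r₂ : ℝ) : ℝ :=
  r₁ + r₂ * (l₁ * conj l₁).re + (conj a₂ * l₁ * a₁).im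

/-- Composing denominators produces the cross term ā₂l₁a₁, whereas |a₁ + a₂l̄₁|²/2 accounts only for
its real part. The imaginary part is what is added to r. -/
theorem mulR_cast (l₁ a₁ a₂ : ℂ) (r₁ r₂ : ℝ) :
    I * (mulR l₁ a₁ a₂ r₁ r₂ : ℂ) = I * r₁ + I * r₂ * (l₁ * conj l₁)
      + (conj a₂ * l₁ * a₁ - a₂ * conj l₁ * conj a₁) / 2 := by
  have h1 : ((l₁ * conj l₁).re : ℂ) = l₁ * conj l₁ := by
    rw [Complex.mul_conj]; simp
  have h2 : ((conj a₂ * l₁ * a₁).im : ℂ) =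
      (conj a₂ * l₁ * a₁ - a₂ * conj l₁ * conj a₁) / (2 * I) := by
    rw [Complex.im_eq_sub_conj]
    simp
  unfold mulR
  push_cast
  rw [h1, h2]
  field_simp

/-- The denominators form a multiplicative cocycle (`h3`). Once this is known, both numerators agree
after clearing denominators. -/
theorem heisMap_comp (l₁ a₁ l₂ a₂ : ℂ) (r₁ r₂ : ℝ) :
    heisMap l₂ a₂ r₂ ∘ heisMap l₁ a₁ r₁ =ᶠ[𝓝 0]
      heisMap (l₂ * l₁) (a₁ + a₂ * conj l₁) (mulR l₁ a₁ a₂ r₁ r₂) := by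
  filter_upwards [heisDenom_eventually_ne a₁ r₁,
    (heisMap_tendsto l₁ a₁ r₁).eventually (heisDenom_eventually_ne a₂ r₂)] with y h1 h2
  have h3 : heisDenom (a₁ + a₂ * conj l₁) (mulR l₁ a₁ a₂ r₁ r₂) y
      = heisDenom a₁ r₁ y * heisDenom a₂ r₂ (heisMap l₁ a₁ r₁ y) := by
    have e1 := mulR_cast l₁ a₁ a₂ r₁ r₂
    have e2 : heisDenom a₁ r₁ y * heisDenom a₂ r₂ (heisMap l₁ a₁ r₁ y)
        = heisDenom a₁ r₁ y + conj a₂ * (l₁ * (y.1 + a₁ * y.2))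
          + (a₂ * conj a₂ / 2 + I * r₂) * (l₁ * conj l₁ * y.2) := by
      rw [heisDenom, heisDenom, heisMap]
      change _ * (1 + conj a₂ * (_ / heisDenom a₁ r₁ y) + _ * (_ / heisDenom a₁ r₁ y)) = _
      rw [← heisDenom]
      field_simp
    rw [e2, heisDenom, heisDenom, e1]
    simp only [map_add, map_mul, conj_conj]
    ring
  have e : heisMap l₂ a₂ r₂ (heisMap l₁ a₁ r₁ y) =
    (l₂ * ((heisMap l₁ a₁ r₁ y).1 + a₂ * (heisMap l₁ a₁ r₁ y).2)
        / heisDenom a₂ r₂ (heisMap l₁ a₁ r₁ y),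
      l₂ * conj l₂ * (heisMap l₁ a₁ r₁ y).2 / heisDenom a₂ r₂ (heisMap l₁ a₁ r₁ y)) := rfl
  rw [Function.comp_apply, e, heisMap.eq_1 (l₂ * l₁), h3]
  ext
  · simp only [heisMap] at h2 ⊢
    field_simp
    ring
  · simp only [heisMap, map_mul] at h2 ⊢
    field_simp

theorem heisMap_one_zero_zero : heisMap 1 0 0 = id := by
  ext y <;> simp [heisMap, heisDenom]

/-- The parameters of the inverse of a linear fractional isotropy. -/
theorem heisInv_param {l : ℂ} (hl : l ≠ 0) (a : ℂ) (r : ℝ) :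
    l⁻¹ * l = 1 ∧ a + -a / conj l * conj l = 0 ∧
      mulR l a (-a / conj l) r (-r / (l * conj l).re) = 0 := by
  have hl' : conj l ≠ 0 := by simpa using hl
  have h0 : (l * conj l).re ≠ 0 := by
    rw [Complex.mul_conj, ofReal_re]
    simpa using hl
  refine ⟨inv_mul_cancel₀ hl, by field_simp; ring, ?_⟩
  have : conj (-a / conj l) * l * a = -(a * conj a) := by
    simp only [map_div₀, map_neg, conj_conj]
    field_simp
  rw [mulR, this, Complex.mul_conj a]
  simp only [neg_im, ofReal_im]
  field_simp
  ring

theorem heisMap_leftInverse {l : ℂ} (hl : l ≠ 0) (a : ℂ) (r : ℝ) :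
    heisMap l⁻¹ (-a / conj l) (-r / (l * conj l).re) ∘ heisMap l a r =ᶠ[𝓝 0] id := by
  refine (heisMap_comp _ _ _ _ _ _).trans ?_
  obtain ⟨h1, h2, h3⟩ := heisInv_param hl a r
  rw [h1, h2, h3, heisMap_one_zero_zero]

/-- Under this map the defining function V + V̄ - |Z|² is multiplied by |l|² / |δ|², where δ is the
denominator; the terms in r cancel. Invertibility of the derivative comes from the explicit left
inverse. -/
theorem heisMap_isotropy {l : ℂ} (hl : l ≠ 0) (a : ℂ) (r : ℝ) :
    IsLocalIsotropy heisenberg 0 (heisMap l a r) where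
  analyticAt := heisMap_analyticAt_zero l a r
  map_point := heisMap_zero l a r
  map_mem := by
    filter_upwards [heisDenom_eventually_ne a r] with y hy hmem
    have hy' : conj (heisDenom a r y) ≠ 0 := by simpa using hy
    simp only [heisenberg, Set.mem_ofPred_eq, heisMap] at hmem ⊢
    simp only [map_div₀, map_mul, conj_conj, map_add]
    field_simp
    simp only [heisDenom, map_add, map_mul, map_one, conj_conj, conj_I, conj_ofReal, map_div₀,
      map_ofNat]
    linear_combination (conj l) * hmem
  det_ne_zero := by
    refine (det_fderiv_ne_zero_of_comp_eq_id (G := heisMap l a r) ?_ ?_ (heisMap_leftInverse hl a r)).2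
    · rw [heisMap_zero]
      exact (heisMap_analyticAt_zero _ _ _).differentiableAt
    · exact (heisMap_analyticAt_zero _ _ _).differentiableAt

/-! ### Rigidity of the Heisenberg hypersurface -/

/-- The functional equation which characterises the chains of the Heisenberg hypersurface. -/
theorem eq_fractional_of_functional_equation {γ φ : ℂ → ℂ} {R : ℝ} (hR : 0 < R)
    (hφ : ∀ V, ‖V‖ < R → φ V ≠ 0)
    (hγ : ∀ V, ‖V‖ < R → γ V = -conj (γ (-conj V)))
    (h0 : γ 0 = 0)
    (h : ∀ V y, ‖V‖ < R → ‖y‖ < R → γ V - γ y = φ V * conj (φ (-conj y)) * (V - y)) :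
    ∃ r : ℝ, ∀ V, ‖V‖ < R → 1 + I * r * V ≠ 0 ∧ φ V = φ 0 / (1 + I * r * V) ∧
      γ V = φ 0 * conj (φ 0) * V / (1 + I * r * V) := by
  set l := φ 0 with hl
  have h0R : ‖(0 : ℂ)‖ < R := by simpa using hR
  have hl0 : l ≠ 0 := hφ 0 h0R
  have hl0' : conj l ≠ 0 := by simpa using hl0
  -- Setting y = 0 and then V = 0 gives two formulas for γ. Comparing them expresses φ* through φ,
  -- and the equation then says that (1/φ(V) - 1/φ(0)) / V is constant.
  have e1 : ∀ V, ‖V‖ < R → γ V = φ V * conj l * V := by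
    intro V hV
    have := h V 0 hV h0R
    simpa [h0] using this
  have e2 : ∀ y, ‖y‖ < R → γ y = l * conj (φ (-conj y)) * y := by
    intro y hy
    have := h 0 y h0R hy
    rw [h0] at this
    linear_combination -this
  have e3 : ∀ y, ‖y‖ < R → conj (φ (-conj y)) = φ y * conj l / l := by
    intro y hy
    by_cases hy0 : y = 0
    · subst hy0
      simp only [map_zero, neg_zero]
      rw [← hl]
      field_simp
    · have := (e1 y hy).symm.trans (e2 y hy)
      have := mul_right_cancel₀ hy0 this
      field_simp
      linear_combination -this
  have e4 : ∀ V y, ‖V‖ < R → ‖y‖ < R → V * (1 / φ y - 1 / l) = y * (1 / φ V - 1 / l) := by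
    intro V y hV hy
    have h1 := h V y hV hy
    rw [e1 V hV, e1 y hy, e3 y hy] at h1
    have hV0 := hφ V hV
    have hy0 := hφ y hy
    have h2 : (φ V * V - φ y * y) * l = φ V * φ y * (V - y) := by
      field_simp at h1
      have := mul_left_cancel₀ hl0' (a := conj l) (b := (φ V * V - φ y * y) * l)
        (c := φ V * φ y * (V - y)) (by linear_combination (conj l) * h1)
      exact this
    field_simp
    linear_combination h2
  -- the slope
  set V₀ : ℂ := ((R / 2 : ℝ) : ℂ) with hV₀
  have hV₀n : ‖V₀‖ < R := by
    rw [hV₀, Complex.norm_real, Real.norm_of_nonneg (by positivity)]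
    linarith
  have hV₀0 : V₀ ≠ 0 := by
    rw [hV₀]
    exact_mod_cast (by positivity : (R / 2 : ℝ) ≠ 0)
  set c : ℂ := (1 / φ V₀ - 1 / l) / V₀ with hc
  have e5 : ∀ V, ‖V‖ < R → 1 / φ V = 1 / l + c * V := by
    intro V hV
    have := e4 V V₀ hV hV₀n
    rw [hc]
    field_simp at this ⊢
    linear_combination -this
  have e6 : ∀ V, ‖V‖ < R → 1 + l * c * V ≠ 0 ∧ φ V = l / (1 + l * c * V) := by
    intro V hV
    have h1 := e5 V hV
    have h2 : 1 + l * c * V = l / φ V := by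
      have : 1 + l * c * V = l * (1 / l + c * V) := by field_simp
      rw [this, ← h1]
      ring
    have h3 := hφ V hV
    refine ⟨?_, ?_⟩
    · rw [h2]
      exact div_ne_zero hl0 h3
    · rw [h2]
      field_simp
  have e7 : l * c + conj (l * c) = 0 := by
    have h1 := hγ V₀ hV₀n
    have hc₀ : conj V₀ = V₀ := conj_ofReal _
    have hm : ‖-V₀‖ < R := by rwa [norm_neg]
    rw [hc₀, e1 V₀ hV₀n, e1 (-V₀) hm, (e6 V₀ hV₀n).2, (e6 _ hm).2] at h1
    have h2 := (e6 V₀ hV₀n).1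
    have h3 : conj (1 + l * c * -V₀) ≠ 0 := (map_ne_zero _).2 (e6 _ hm).1
    simp only [map_mul, map_div₀, map_neg, conj_conj, hc₀] at h1
    have h4 : conj (1 + l * c * -V₀) = 1 - V₀ * conj (l * c) := by
      simp only [map_add, map_one, map_mul, map_neg, hc₀]
      ring
    rw [h4] at h1 h3
    clear_value c
    field_simp at h1
    have h5 : V₀ * (l * c + conj (l * c)) = 0 := by
      linear_combination -h1
    exact (mul_eq_zero.1 h5).resolve_left hV₀0
  have e8 : l * c = I * ((l * c).im : ℂ) := by
    have hre : (l * c).re = 0 := by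
      have := congrArg re e7
      simp only [add_re, conj_re, zero_re] at this
      linarith
    apply Complex.ext
    · simpa using hre
    · simp
  refine ⟨(l * c).im, fun V hV => ?_⟩
  rw [← e8]
  refine ⟨(e6 V hV).1, (e6 V hV).2, ?_⟩
  rw [e1 V hV, (e6 V hV).2]
  ring

/-- Components of an analytic map along the coordinate directions. -/
theorem hasDerivAt_slice_fst {F : ℂ × ℂ → ℂ} {Z V : ℂ} (h : DifferentiableAt ℂ F (Z, V)) :
    HasDerivAt (fun t => F (t, V)) (fderiv ℂ F (Z, V) (1, 0)) Z :=
  h.hasFDerivAt.comp_hasDerivAt Z ((hasDerivAt_id Z).prodMk (hasDerivAt_const Z V))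

theorem hasDerivAt_slice_snd {F : ℂ × ℂ → ℂ} {Z V : ℂ} (h : DifferentiableAt ℂ F (Z, V)) :
    HasDerivAt (fun t => F (Z, t)) (fderiv ℂ F (Z, V) (0, 1)) V :=
  h.hasFDerivAt.comp_hasDerivAt V ((hasDerivAt_const V Z).prodMk (hasDerivAt_id V))

/-- The second component of an isotropy vanishes on the complex tangent line, so that the
diagonal entries of its derivative do not vanish. -/
theorem IsLocalIsotropy.diag_ne_zero {F : ℂ × ℂ → ℂ × ℂ} (hF : IsLocalIsotropy heisenberg 0 F) :
    fderiv ℂ (fun x => (F x).1) (0, 0) (1, 0) ≠ 0 ∧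
      fderiv ℂ (fun x => (F x).2) (0, 0) (0, 1) ≠ 0 := by
  obtain ⟨R, hR, han, hid⟩ := heisenberg_polarize hF.analyticAt hF.map_mem
  have hd : DifferentiableAt ℂ F (0, 0) := hF.analyticAt.differentiableAt
  have hF0 : F (0, 0) = 0 := hF.map_point
  -- Putting V = ζ = 0 in the polarised identity leaves only the second component, since F fixes the
  -- origin. The derivative at 0 is therefore triangular.
  have h1 : ∀ Z : ℂ, ‖Z‖ < R → (F (Z, 0)).2 = 0 := by
    intro Z hZ
    have := hid Z 0 0 hZ (by simpa using hR) (by simpa using hR)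
    simpa [conjFun, hF0] using this
  have h2 : fderiv ℂ (fun x => (F x).2) (0, 0) (1, 0) = 0 := by
    have h3 := hasDerivAt_slice_fst hd.snd
    have h4 : (fun t : ℂ => (F (t, 0)).2) =ᶠ[𝓝 0] fun _ => 0 := by
      filter_upwards [Metric.ball_mem_nhds (0 : ℂ) hR] with Z hZ
      exact h1 Z (by simpa using hZ)
    exact (h3.congr_of_eventuallyEq h4.symm).unique (hasDerivAt_const (0 : ℂ) (0 : ℂ))
  have h5 := hF.det_ne_zero
  have e1 : ∀ v, (fderiv ℂ F (0, 0) v).1 = fderiv ℂ (fun x => (F x).1) (0, 0) v := by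
    intro v
    rw [hd.hasFDerivAt.fst.fderiv]
    rfl
  have e2 : ∀ v, (fderiv ℂ F (0, 0) v).2 = fderiv ℂ (fun x => (F x).2) (0, 0) v := by
    intro v
    rw [hd.hasFDerivAt.snd.fderiv]
    rfl
  rw [det_prod_complex] at h5
  change (fderiv ℂ F (0, 0) (1, 0)).1 * (fderiv ℂ F (0, 0) (0, 1)).2
    - (fderiv ℂ F (0, 0) (0, 1)).1 * (fderiv ℂ F (0, 0) (1, 0)).2 ≠ 0 at h5
  rw [e1, e2, e1, e2, h2, mul_zero, sub_zero] at h5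
  exact ⟨left_ne_zero_of_mul h5, right_ne_zero_of_mul h5⟩

/-- The transversal line through the origin is mapped into a line. -/
theorem IsLocalIsotropy.transversal_line {F : ℂ × ℂ → ℂ × ℂ}
    (hF : IsLocalIsotropy heisenberg 0 F) :
    ∃ k : ℂ, ∀ᶠ V in 𝓝 (0 : ℂ), (F (0, V)).1 = k * (F (0, V)).2 := by
  obtain ⟨R, hR, han, hid⟩ := heisenberg_polarize hF.analyticAt hF.map_mem
  have hF0 : F (0, 0) = 0 := hF.map_point
  have h1 : ∀ Z : ℂ, ‖Z‖ < R → (F (Z, 0)).2 = 0 := by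
    intro Z hZ
    have := hid Z 0 0 hZ (by simpa using hR) (by simpa using hR)
    simpa [conjFun, hF0] using this
  -- On the line V = αZ, taking ζ = α puts the conjugate point at (α, 0), where g* vanishes. The
  -- ratio g/f is then governed by a constant depending only on α.
  have h2 : ∀ Z α : ℂ, ‖Z‖ < R → ‖α‖ < R → ‖Z * α‖ < R →
      (F (Z, Z * α)).2 = (F (Z, Z * α)).1 * conjFun (fun x => (F x).1) (α, 0) := by
    intro Z α hZ hα hZα
    have h3 := hid Z (Z * α) α hZ hZα hα
    rw [sub_self] at h3
    have h4 : conjFun (fun x => (F x).2) (α, 0) = 0 := by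
      have := h1 (conj α) (by simpa using hα)
      simp [conjFun, this]
    rwa [h4, add_zero] at h3
  -- collinearity of the images of `0`, `x` and `t x`
  have h5 : ∀ Z V t : ℂ, Z ≠ 0 → ‖Z‖ < R → ‖V‖ < R → ‖V‖ < R * ‖Z‖ → ‖t‖ ≤ 1 →
      (F (Z, V)).1 * (F (t * Z, t * V)).2 = (F (Z, V)).2 * (F (t * Z, t * V)).1 := by
    intro Z V t hZ0 hZ hV hVZ ht
    have e : Z * (V / Z) = V := by field_simp
    have hα : ‖V / Z‖ < R := by
      rw [norm_div, div_lt_iff₀ (norm_pos_iff.2 hZ0)]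
      exact hVZ
    have a1 := h2 Z (V / Z) hZ hα (by rwa [e])
    have e' : t * Z * (V / Z) = t * V := by field_simp
    have htZ : ‖t * Z‖ < R := by
      rw [norm_mul]
      nlinarith [norm_nonneg Z, norm_nonneg t]
    have htV : ‖t * V‖ < R := by
      rw [norm_mul]
      nlinarith [norm_nonneg V, norm_nonneg t]
    have a2 := h2 (t * Z) (V / Z) htZ hα (by rwa [e'])
    rw [e] at a1
    rw [e'] at a2
    rw [a1, a2]
    ring
  have h6 : ∀ V t : ℂ, ‖V‖ < R → ‖V‖ < R * (R / 2) → ‖t‖ ≤ 1 →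
      (F (0, V)).1 * (F (0, t * V)).2 = (F (0, V)).2 * (F (0, t * V)).1 := by
    intro V t hV hV2 ht
    -- Collinearity is known only for |Z| away from 0, where the slope V/Z is small. The determinant
    -- is holomorphic in Z on the whole disc, so it also vanishes at Z = 0.
    let h : ℂ → ℂ := fun Z =>
      (F (Z, V)).1 * (F (t * Z, t * V)).2 - (F (Z, V)).2 * (F (t * Z, t * V)).1
    have hd : AnalyticOnNhd ℂ h (Metric.ball 0 R) := by
      apply DifferentiableOn.analyticOnNhd _ Metric.isOpen_ball
      intro Z hZ
      rw [mem_ball_zero_iff] at hZ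
      apply DifferentiableAt.differentiableWithinAt
      have d1 : DifferentiableAt ℂ (fun Z => F (Z, V)) Z :=
        (han (Z, V) (max_lt hZ hV)).differentiableAt.comp Z
          (by fun_prop : DifferentiableAt ℂ (fun Z : ℂ => (Z, V)) Z)
      have d2 : DifferentiableAt ℂ (fun Z => F (t * Z, t * V)) Z := by
        refine DifferentiableAt.comp (g := F) (f := fun Z : ℂ => (t * Z, t * V)) Z
          (han (t * Z, t * V) (max_lt ?_ ?_)).differentiableAt (by fun_prop)
        · simp only [norm_mul]
          nlinarith [norm_nonneg Z, norm_nonneg t]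
        · simp only [norm_mul]
          nlinarith [norm_nonneg V, norm_nonneg t]
      exact (d1.fst.mul d2.snd).sub (d1.snd.mul d2.fst)
    have hZ₀ : ((3 * R / 4 : ℝ) : ℂ) ∈ Metric.ball (0 : ℂ) R := by
      rw [mem_ball_zero_iff, Complex.norm_real, Real.norm_of_nonneg (by positivity)]
      linarith
    have hev : h =ᶠ[𝓝 ((3 * R / 4 : ℝ) : ℂ)] 0 := by
      have c1 : ∀ᶠ Z : ℂ in 𝓝 ((3 * R / 4 : ℝ) : ℂ), R / 2 < ‖Z‖ := by
        refine continuousAt_const.eventually_lt continuous_norm.continuousAt ?_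
        rw [Complex.norm_real, Real.norm_of_nonneg (by positivity)]
        linarith
      filter_upwards [c1, Metric.isOpen_ball.mem_nhds hZ₀] with Z hZ hZ'
      rw [mem_ball_zero_iff] at hZ'
      have hZ0 : Z ≠ 0 := norm_pos_iff.1 (by linarith)
      exact sub_eq_zero.2 (h5 Z V t hZ0 hZ' hV (hV2.trans_le (by gcongr)) ht)
    have := hd.eqOn_zero_of_preconnected_of_eventuallyEq_zero
      (convex_ball (0 : ℂ) R).isPreconnected hZ₀ hev (Metric.mem_ball_self hR)
    simpa [h, sub_eq_zero] using this
  -- a point of the line with non-zero second component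
  have hd := hasDerivAt_slice_snd (hF.analyticAt.differentiableAt (x := ((0, 0) : ℂ × ℂ))).snd
  have hne : ∀ᶠ V in 𝓝[≠] (0 : ℂ), (F (0, V)).2 ≠ 0 := by
    have := hd.eventually_ne (c := 0) hF.diag_ne_zero.2
    simpa [hF0] using this
  have hsmall : ∀ᶠ V in 𝓝[≠] (0 : ℂ), ‖V‖ < min R (R * (R / 2)) := by
    have : Metric.ball (0 : ℂ) (min R (R * (R / 2))) ∈ 𝓝 0 :=
      Metric.ball_mem_nhds _ (lt_min hR (by positivity))
    filter_upwards [nhdsWithin_le_nhds this] with V hV using by simpa using hV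
  obtain ⟨V₀, ⟨hV1, hV2⟩, hV3⟩ := ((hne.and hsmall).and self_mem_nhdsWithin).exists
  have hV0 : V₀ ≠ 0 := hV3
  refine ⟨(F (0, V₀)).1 / (F (0, V₀)).2, ?_⟩
  filter_upwards [Metric.ball_mem_nhds (0 : ℂ) (norm_pos_iff.2 hV0)] with V hV
  rw [mem_ball_zero_iff] at hV
  have ht : ‖V / V₀‖ ≤ 1 := by
    rw [norm_div, div_le_one (norm_pos_iff.2 hV0)]
    exact hV.le
  have := h6 V₀ (V / V₀) (hV2.trans_le (min_le_left _ _)) (hV2.trans_le (min_le_right _ _)) ht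
  rw [div_mul_cancel₀ _ hV0] at this
  field_simp
  linear_combination -this

/-- An isotropy of the Heisenberg hypersurface which preserves the transversal line is
`(Z, V) ↦ (l Z, |l|² V) / (1 + i r V)`. -/
theorem IsLocalIsotropy.eq_heisMap_of_transversal {F : ℂ × ℂ → ℂ × ℂ}
    (hF : IsLocalIsotropy heisenberg 0 F) (hv : ∀ᶠ V in 𝓝 (0 : ℂ), (F (0, V)).1 = 0) :
    ∃ (l : ℂ) (r : ℝ), l ≠ 0 ∧ F =ᶠ[𝓝 0] heisMap l 0 r := by
  obtain ⟨R, hR, han, hid⟩ := heisenberg_polarize hF.analyticAt hF.map_mem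
  have hF0 : F (0, 0) = 0 := hF.map_point
  have hd0 : DifferentiableAt ℂ F (0, 0) := hF.analyticAt.differentiableAt
  let γ : ℂ → ℂ := fun V => (F (0, V)).2
  have hγan : AnalyticAt ℂ γ 0 := by
    have h1 : AnalyticAt ℂ (fun V : ℂ => ((0, V) : ℂ × ℂ)) 0 :=
      analyticAt_const.prod analyticAt_id
    exact analyticAt_snd.comp (AnalyticAt.comp (g := F) (by exact hF.analyticAt) h1)
  have hγ' : ∀ᶠ V in 𝓝 (0 : ℂ), deriv γ V ≠ 0 := by
    refine hγan.deriv.continuousAt.eventually_ne ?_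
    rw [(hasDerivAt_slice_snd hd0.snd).deriv]
    exact hF.diag_ne_zero.2
  obtain ⟨r₁, hr₁, hball⟩ := Metric.eventually_nhds_iff.1 (hv.and hγ')
  simp only [dist_zero_right] at hball
  set ρ : ℝ := min (min R r₁) 1 with hρ
  have hρ0 : 0 < ρ := lt_min (lt_min hR hr₁) one_pos
  have hρR : ρ ≤ R := (min_le_left _ _).trans (min_le_left _ _)
  have hρr : ρ ≤ r₁ := (min_le_left _ _).trans (min_le_right _ _)
  have hρ1 : ρ ≤ 1 := min_le_right _ _
  clear_value ρ
  have hf0 : ∀ V : ℂ, ‖V‖ < ρ → (F (0, V)).1 = 0 := fun V hV => (hball (hV.trans_le hρr)).1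
  have hγ0 : ∀ V : ℂ, ‖V‖ < ρ → deriv γ V ≠ 0 := fun V hV => (hball (hV.trans_le hρr)).2
  have hcf0 : ∀ V : ℂ, ‖V‖ < ρ → conjFun (fun x => (F x).1) (0, V) = 0 := by
    intro V hV
    simp [conjFun, hf0 (conj V) (by simpa using hV)]
  -- For ζ = 0 the factor f*(0, ·) vanishes because Z = 0 is preserved, so g does not depend on Z.
  have hg : ∀ Z V : ℂ, ‖Z‖ < ρ → ‖V‖ < ρ → (F (Z, V)).2 = -conj (γ (-conj V)) := by
    intro Z V hZ hV
    have h1 := hid Z V 0 (hZ.trans_le hρR) (hV.trans_le hρR) (by simpa using hR)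
    rw [mul_zero, zero_sub, hcf0 (-V) (by simpa using hV), mul_zero] at h1
    rw [eq_neg_of_add_eq_zero_left h1]
    simp [conjFun, γ]
  have h0ρ : ‖(0 : ℂ)‖ < ρ := by simpa using hρ0
  have hγsymm : ∀ V : ℂ, ‖V‖ < ρ → γ V = -conj (γ (-conj V)) := fun V hV => hg 0 V h0ρ hV
  have hgγ : ∀ Z V : ℂ, ‖Z‖ < ρ → ‖V‖ < ρ → (F (Z, V)).2 = γ V := fun Z V hZ hV =>
    (hg Z V hZ hV).trans (hγsymm V hV).symm
  have hcg : ∀ ζ η : ℂ, ‖ζ‖ < ρ → ‖η‖ < ρ →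
      conjFun (fun x => (F x).2) (ζ, η) = -γ (-η) := by
    intro ζ η hζ hη
    have h1 := hgγ (conj ζ) (conj η) (by simpa using hζ) (by simpa using hη)
    have h2 := hγsymm (-η) (by simpa using hη)
    simp only [map_neg, neg_neg] at h2
    rw [h2, neg_neg]
    simp only [conjFun]
    rw [h1]
  have hid' : ∀ Z V ζ : ℂ, ‖Z‖ < ρ → ‖V‖ < ρ → ‖ζ‖ < ρ → ‖Z * ζ - V‖ < ρ →
      γ V - γ (V - Z * ζ) = (F (Z, V)).1 * conjFun (fun x => (F x).1) (ζ, Z * ζ - V) := by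
    intro Z V ζ hZ hV hζ hη
    have h1 := hid Z V ζ (hZ.trans_le hρR) (hV.trans_le hρR) (hζ.trans_le hρR)
    rw [hcg ζ _ hζ hη, hgγ Z V hZ hV, neg_sub] at h1
    rw [← h1]
    ring
  -- the derivative along the Segre varieties
  let e : ℂ → ℂ := fun V => fderiv ℂ (conjFun fun x => (F x).1) (0, -V) (1, 0)
  have hder : ∀ Z V : ℂ, ‖Z‖ < ρ → ‖V‖ < ρ → Z * deriv γ V = (F (Z, V)).1 * e V := by
    -- Both sides of `hid'` are differentiated in ζ at ζ = 0, which shows that f is linear in Z for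
    -- fixed V.
    intro Z V hZ hV
    have hγd : DifferentiableAt ℂ γ V := by
      have h1 : DifferentiableAt ℂ F (0, V) :=
        (han (0, V) (max_lt (h0ρ.trans_le hρR) (hV.trans_le hρR))).differentiableAt
      exact (hasDerivAt_slice_snd h1.snd).differentiableAt
    have hcd : DifferentiableAt ℂ (conjFun fun x => (F x).1) (0, -V) := by
      apply conjFun_differentiableAt
      refine (han _ (max_lt ?_ ?_)).differentiableAt.fst
      · simpa using hR
      · simpa using hV.trans_le hρR
    have h1 : HasDerivAt (fun ζ => γ V - γ (V - Z * ζ)) (Z * deriv γ V) 0 := by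
      have a1 : HasDerivAt (fun ζ : ℂ => V - Z * ζ) (-Z) 0 := by
        simpa using ((hasDerivAt_id (0 : ℂ)).const_mul Z).const_sub V
      have a2 : HasDerivAt γ (deriv γ V) (V - Z * 0) := by simpa using hγd.hasDerivAt
      have a3 := (a2.comp (0 : ℂ) a1).const_sub (γ V)
      have a4 : Z * deriv γ V = -(deriv γ V * -Z) := by ring
      rw [a4]
      exact a3
    have h2 : HasDerivAt (fun ζ => (F (Z, V)).1 * conjFun (fun x => (F x).1) (ζ, Z * ζ - V))
        ((F (Z, V)).1 * e V) 0 := by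
      have a1 : HasDerivAt (fun ζ : ℂ => ((ζ, Z * ζ - V) : ℂ × ℂ)) (1, Z) 0 := by
        refine (hasDerivAt_id (0 : ℂ)).prodMk ?_
        simpa using ((hasDerivAt_id (0 : ℂ)).const_mul Z).sub_const V
      have a2 : HasFDerivAt (conjFun fun x => (F x).1)
          (fderiv ℂ (conjFun fun x => (F x).1) (0, -V)) (0, Z * 0 - V) := by
        simpa using hcd.hasFDerivAt
      have a3 := (a2.comp_hasDerivAt (0 : ℂ) a1).const_mul (F (Z, V)).1
      -- Since f* vanishes along the line with first coordinate 0, only the partial derivative in ζ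
      -- contributes.
      have a4 : fderiv ℂ (conjFun fun x => (F x).1) (0, -V) (0, 1) = 0 := by
        have b1 := hasDerivAt_slice_snd hcd
        have b2 : (fun t => conjFun (fun x => (F x).1) (0, t)) =ᶠ[𝓝 (-V)] fun _ => 0 := by
          have : -V ∈ Metric.ball (0 : ℂ) ρ := by simpa using hV
          filter_upwards [Metric.isOpen_ball.mem_nhds this] with t ht
          exact hcf0 t (by simpa using ht)
        exact (b1.congr_of_eventuallyEq b2.symm).unique (hasDerivAt_const _ _)
      have a5 : ((1, Z) : ℂ × ℂ) = (1, 0) + Z • (0, 1) := by ext <;> simp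
      rw [a5, map_add, map_smul, a4, smul_zero, add_zero] at a3
      exact a3
    refine h1.unique (h2.congr_of_eventuallyEq ?_)
    have c1 : ∀ᶠ ζ : ℂ in 𝓝 0, ‖Z * ζ - V‖ < ρ := by
      have : Continuous fun ζ : ℂ => ‖Z * ζ - V‖ := by fun_prop
      exact this.continuousAt.eventually_lt continuousAt_const (by simpa using hV)
    filter_upwards [c1, Metric.ball_mem_nhds (0 : ℂ) hρ0] with ζ h3 h4
    exact hid' Z V ζ hZ hV (by simpa using h4) h3
  let φ : ℂ → ℂ := fun V => deriv γ V / e V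
  obtain ⟨Z₀, hZ₀, hZ₀ρ⟩ : ∃ Z₀ : ℂ, Z₀ ≠ 0 ∧ ‖Z₀‖ = ρ / 2 := by
    refine ⟨((ρ / 2 : ℝ) : ℂ), by exact_mod_cast (by positivity : ρ / 2 ≠ 0), ?_⟩
    rw [Complex.norm_real, Real.norm_of_nonneg (by positivity)]
  have he : ∀ V : ℂ, ‖V‖ < ρ → e V ≠ 0 := by
    intro V hV h
    have h1 := hder Z₀ V (by linarith) hV
    rw [h, mul_zero] at h1
    exact mul_ne_zero hZ₀ (hγ0 V hV) h1
  have hf : ∀ Z V : ℂ, ‖Z‖ < ρ → ‖V‖ < ρ → (F (Z, V)).1 = Z * φ V := by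
    intro Z V hZ hV
    have h1 := hder Z V hZ hV
    have h2 := he V hV
    simp only [φ]
    field_simp
    exact h1.symm
  have hφ : ∀ V : ℂ, ‖V‖ < ρ → φ V ≠ 0 := fun V hV => div_ne_zero (hγ0 V hV) (he V hV)
  -- With |Z₀| = ρ/2, this radius guarantees |(V - y)/Z₀| < ρ. Hence ζ = (V - y)/Z₀ is admissible
  -- and Zζ - V = -y.
  have hτ : 0 < ρ ^ 2 / 4 := by positivity
  have hτρ : ρ ^ 2 / 4 < ρ := by nlinarith
  obtain ⟨r, hr⟩ := eq_fractional_of_functional_equation (γ := γ) (φ := φ) hτ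
    (fun V hV => hφ V (hV.trans hτρ)) (fun V hV => hγsymm V (hV.trans hτρ)) (by simp [γ, hF0])
    (by
      intro V y hV hy
      have hVρ := hV.trans hτρ
      have hyρ := hy.trans hτρ
      have hζ : ‖(V - y) / Z₀‖ < ρ := by
        rw [norm_div, hZ₀ρ, div_lt_iff₀ (by positivity)]
        have := norm_sub_le V y
        nlinarith
      have e1 : Z₀ * ((V - y) / Z₀) = V - y := by field_simp
      have h1 := hid' Z₀ V ((V - y) / Z₀) (by linarith) hVρ hζ (by
        rw [e1]; simpa using hyρ)
      rw [e1] at h1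
      rw [sub_sub_cancel, hf Z₀ V (by linarith) hVρ, conjFun] at h1
      simp only [sub_sub_cancel_left, map_neg] at h1
      rw [hf _ _ (by rwa [RCLike.norm_conj]) (by simpa using hyρ), map_mul, conj_conj] at h1
      rw [h1]
      field_simp)
  refine ⟨φ 0, r, hφ 0 h0ρ, ?_⟩
  have hnhds : Metric.ball (0 : ℂ × ℂ) (ρ ^ 2 / 4) ∈ 𝓝 0 := Metric.ball_mem_nhds _ hτ
  filter_upwards [hnhds] with ⟨Z, V⟩ hx
  rw [mem_ball_zero_iff] at hx
  have hZ : ‖Z‖ < ρ ^ 2 / 4 := (le_max_left _ _).trans_lt hx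
  have hV : ‖V‖ < ρ ^ 2 / 4 := (le_max_right _ _).trans_lt hx
  obtain ⟨-, h2, h3⟩ := hr V hV
  ext
  · rw [hf Z V (hZ.trans hτρ) (hV.trans hτρ), h2]
    simp only [heisMap, heisDenom]
    simp
    ring
  · rw [hgγ Z V (hZ.trans hτρ) (hV.trans hτρ), h3]
    simp only [heisMap, heisDenom]
    simp

/-- The isotropies of the Heisenberg hypersurface are linear fractional. -/
theorem IsLocalIsotropy.eq_heisMap {F : ℂ × ℂ → ℂ × ℂ} (hF : IsLocalIsotropy heisenberg 0 F) :
    ∃ (l a : ℂ) (r : ℝ), l ≠ 0 ∧ F =ᶠ[𝓝 0] heisMap l a r := by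
  obtain ⟨k, hk⟩ := hF.transversal_line
  -- The numerator Z - kV vanishes on the line Z = kV, which contains F(0, V). After the composition
  -- the line Z = 0 is preserved. The inverse correction belongs to the same family and is absorbed
  -- by `heisMap_comp`.
  have h1 : IsLocalIsotropy heisenberg 0 (heisMap 1 (-k) 0 ∘ F) :=
    (heisMap_isotropy one_ne_zero (-k) 0).comp hF
  obtain ⟨l, r, hl, h2⟩ := h1.eq_heisMap_of_transversal (by
    filter_upwards [hk] with V hV
    simp [heisMap, hV])
  have h3 := hF.tendsto.eventually (heisMap_leftInverse one_ne_zero (-k) 0)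
  refine ⟨_, _, _, ?_, EventuallyEq.trans ?_ (heisMap_comp l 0 (1 : ℂ)⁻¹ (-(-k) / conj 1) r
    (-0 / ((1 : ℂ) * conj 1).re))⟩
  · simpa using hl
  · filter_upwards [h2, h3] with x hx hx'
    have hx'' : heisMap 1⁻¹ (- -k / conj 1) (-0 / ((1 : ℂ) * conj 1).re)
      (heisMap 1 (-k) 0 (F x)) = F x := hx'
    rw [Function.comp_apply] at hx ⊢
    rw [← hx, hx'']

/-! ### Transport of isotropies along local biholomorphisms -/

/-- `φ` is a local biholomorphism from `(M, p)` to `(N, q)` with local inverse `ψ`. -/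
structure IsLocalBihol (M : Set (ℂ × ℂ)) (p : ℂ × ℂ) (N : Set (ℂ × ℂ)) (q : ℂ × ℂ)
    (φ ψ : ℂ × ℂ → ℂ × ℂ) : Prop where
  analyticAt : AnalyticAt ℂ φ p
  analyticAt_inv : AnalyticAt ℂ ψ q
  map_point : φ p = q
  map_point_inv : ψ q = p
  left_inv : ∀ᶠ x in 𝓝 p, ψ (φ x) = x
  right_inv : ∀ᶠ y in 𝓝 q, φ (ψ y) = y
  mem_iff : ∀ᶠ x in 𝓝 p, x ∈ M ↔ φ x ∈ N

section

variable {M N : Set (ℂ × ℂ)} {p q : ℂ × ℂ} {φ ψ : ℂ × ℂ → ℂ × ℂ}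

theorem IsLocalBihol.tendsto (h : IsLocalBihol M p N q φ ψ) : Tendsto φ (𝓝 p) (𝓝 q) := by
  have := h.analyticAt.continuousAt.tendsto
  rwa [h.map_point] at this

theorem IsLocalBihol.tendsto_inv (h : IsLocalBihol M p N q φ ψ) : Tendsto ψ (𝓝 q) (𝓝 p) := by
  have := h.analyticAt_inv.continuousAt.tendsto
  rwa [h.map_point_inv] at this

theorem IsLocalBihol.symm (h : IsLocalBihol M p N q φ ψ) : IsLocalBihol N q M p ψ φ where
  analyticAt := h.analyticAt_inv
  analyticAt_inv := h.analyticAt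
  map_point := h.map_point_inv
  map_point_inv := h.map_point
  left_inv := h.right_inv
  right_inv := h.left_inv
  mem_iff := by
    filter_upwards [h.tendsto_inv.eventually h.mem_iff, h.right_inv] with y h1 h2
    rw [h1, h2]

/-- Transport of the classification: each condition passes through the chart, and the chain rule
makes the determinant a product of three nonzero factors. -/
theorem IsLocalBihol.conj_isotropy (h : IsLocalBihol M p N q φ ψ) {F : ℂ × ℂ → ℂ × ℂ}
    (hF : IsLocalIsotropy M p F) : IsLocalIsotropy N q (φ ∘ F ∘ ψ) where
  analyticAt := by
    refine AnalyticAt.comp ?_ (AnalyticAt.comp ?_ h.analyticAt_inv)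
    · simp only [Function.comp_apply, h.map_point_inv, hF.map_point]
      exact h.analyticAt
    · rw [h.map_point_inv]
      exact hF.analyticAt
  map_point := by simp [h.map_point_inv, hF.map_point, h.map_point]
  map_mem := by
    filter_upwards [h.symm.mem_iff, h.tendsto_inv.eventually hF.map_mem,
      (hF.tendsto.comp h.tendsto_inv).eventually h.mem_iff] with y h1 h2 h3 hy
    exact h3.1 (h2 (h1.1 hy))
  det_ne_zero := by
    have d1 : DifferentiableAt ℂ φ (F (ψ q)) := by
      rw [h.map_point_inv, hF.map_point]
      exact h.analyticAt.differentiableAt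
    have d2 : DifferentiableAt ℂ F (ψ q) := by
      rw [h.map_point_inv]
      exact hF.analyticAt.differentiableAt
    have d3 : DifferentiableAt ℂ ψ q := h.analyticAt_inv.differentiableAt
    have d4 : DifferentiableAt ℂ φ (ψ q) := by
      rw [h.map_point_inv]
      exact h.analyticAt.differentiableAt
    have h1 := det_fderiv_ne_zero_of_comp_eq_id d4 d3 h.right_inv
    rw [det_fderiv_comp (F := φ) (G := F ∘ ψ) d1 (d2.comp q d3), det_fderiv_comp d2 d3]
    refine mul_ne_zero ?_ (mul_ne_zero ?_ h1.2)
    · have h2 := h1.1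
      simp only [Function.comp_apply, h.map_point_inv, hF.map_point] at h2 ⊢
      exact h2
    · rw [h.map_point_inv]
      exact hF.det_ne_zero

end

/-! ### The boundary of the worm in Heisenberg coordinates -/

theorem mem_frontier_unboundedWorm {x : ℂ × ℂ} (hx : x.1 ≠ 0) :
    x ∈ frontier unboundedWorm ↔
      ‖x.2 - exp (I * (Real.log (‖x.1‖ ^ 2) : ℂ))‖ ^ 2 = 1 := by
  set φ : ℂ × ℂ → ℝ := fun x => ‖x.2 - exp (I * (Real.log (‖x.1‖ ^ 2) : ℂ))‖ ^ 2 with hφ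
  have hc : ContinuousAt φ x := by
    have h1 : ContinuousAt (fun x : ℂ × ℂ => Real.log (‖x.1‖ ^ 2)) x :=
      ContinuousAt.log (by fun_prop) (by simpa using hx)
    have h2 : ContinuousAt (fun x : ℂ × ℂ => (Real.log (‖x.1‖ ^ 2) : ℂ)) x :=
      continuous_ofReal.continuousAt.comp h1
    exact ((continuousAt_snd.sub (continuousAt_const.mul h2).cexp).norm).pow 2
  have hne : ∀ᶠ y : ℂ × ℂ in 𝓝 x, y.1 ≠ 0 := continuousAt_fst.eventually_ne hx
  constructor
  · intro h
    by_contra hne1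
    rcases lt_or_gt_of_ne hne1 with h1 | h1
    · have h2 : unboundedWorm ∈ 𝓝 x := by
        filter_upwards [hc.eventually_lt continuousAt_const h1, hne] with y h3 h4
        exact ⟨h3, h4⟩
      exact h.2 (mem_interior_iff_mem_nhds.2 h2)
    · have h2 : unboundedWormᶜ ∈ 𝓝 x := by
        filter_upwards [continuousAt_const.eventually_lt hc h1] with y h3 h4
        exact (lt_asymm h3) h4.1
      have h3 := mem_closure_iff_nhds.1 h.1 _ h2
      simp at h3
  · intro h
    refine ⟨?_, fun h1 => ?_⟩
    · set c := exp (I * (Real.log (‖x.1‖ ^ 2) : ℂ)) with hcdef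
      -- With z fixed, the slice is a disc centred at c. Shrinking radially in w approaches the
      -- boundary point from inside the domain.
      have ht : Tendsto (fun t : ℝ => ((x.1, c + t * (x.2 - c)) : ℂ × ℂ)) (𝓝[<] 1) (𝓝 x) := by
        have h2 : Continuous fun t : ℝ => ((x.1, c + t * (x.2 - c)) : ℂ × ℂ) := by fun_prop
        refine (h2.tendsto' 1 x ?_).mono_left nhdsWithin_le_nhds
        ext <;> simp
      refine mem_closure_of_tendsto ht ?_
      have h3 : ∀ᶠ t : ℝ in 𝓝[<] 1, t ∈ Set.Ioo (0 : ℝ) 1 := Ioo_mem_nhdsLT one_pos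
      filter_upwards [h3] with t ht
      refine ⟨?_, hx⟩
      change ‖c + t * (x.2 - c) - c‖ ^ 2 < 1
      rw [add_sub_cancel_left, norm_mul, mul_pow, h, Complex.norm_real, mul_one,
        Real.norm_of_nonneg ht.1.le]
      nlinarith [ht.1, ht.2]
    · exact absurd (interior_subset h1).1 (by rw [h]; exact lt_irrefl _)

/-- The coordinates in which the boundary of the worm is the Heisenberg hypersurface. -/
noncomputable def wormChart (x : ℂ × ℂ) : ℂ × ℂ :=
  (x.1 ^ I - 1, (x.1 ^ I) ^ 2 / x.2 - x.1 ^ I + 1 / 2)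

/-- The inverse of `wormChart`. -/
noncomputable def wormChartInv (y : ℂ × ℂ) : ℂ × ℂ :=
  ((1 + y.1) ^ (-I), (1 + y.1) ^ 2 / (y.2 + y.1 + 1 / 2))

/-- The centre of the disc over z is s / s̄. After expanding the square and clearing denominators,
the two equations differ by a nonzero numerical factor. -/
theorem wormChart_mem_heisenberg {x : ℂ × ℂ} (h1 : x.1 ≠ 0) (h2 : x.2 ≠ 0) :
    x ∈ frontier unboundedWorm ↔ wormChart x ∈ heisenberg := by
  rw [mem_frontier_unboundedWorm h1]
  set s : ℂ := x.1 ^ I with hs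
  have hs' : s = exp (log x.1 * I) := cpow_def_of_ne_zero h1 I
  have hs0 : s ≠ 0 := by rw [hs']; exact exp_ne_zero _
  have hcs : conj s = exp (-(conj (log x.1) * I)) := by
    rw [hs', ← exp_conj]
    simp
  have hcs0 : conj s ≠ 0 := by rw [hcs]; exact exp_ne_zero _
  have hlog : ((Real.log (‖x.1‖ ^ 2) : ℝ) : ℂ) = log x.1 + conj (log x.1) := by
    rw [Complex.add_conj, log_re, Real.log_pow]
    push_cast
    ring
  have hc : exp (I * (Real.log (‖x.1‖ ^ 2) : ℂ)) = s / conj s := by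
    rw [hlog, hcs, hs', ← exp_sub]
    congr 1
    ring
  have hw : conj x.2 ≠ 0 := (map_ne_zero _).2 h2
  have hn : ((‖x.2 - s / conj s‖ ^ 2 : ℝ) : ℂ) = (x.2 - s / conj s) * (conj x.2 - conj s / s) := by
    push_cast
    rw [← Complex.mul_conj']
    simp
  rw [hc, ← Complex.ofReal_inj, hn]
  simp only [heisenberg, wormChart, Set.mem_ofPred_eq, ← hs, map_add, map_sub, map_div₀, map_pow,
    map_one, map_ofNat, ofReal_one]
  constructor
  · intro h
    field_simp at h ⊢
    linear_combination (-2) * h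
  · intro h
    field_simp at h ⊢
    linear_combination (-1 / 2) * h

theorem wormChart_analyticAt {x : ℂ × ℂ} (h1 : x.1 ∈ slitPlane) (h2 : x.2 ≠ 0) :
    AnalyticAt ℂ wormChart x := by
  have h3 : AnalyticAt ℂ (fun x : ℂ × ℂ => x.1 ^ I) x :=
    analyticAt_fst.cpow analyticAt_const h1
  exact (h3.sub analyticAt_const).prod
    ((((h3.pow 2).div analyticAt_snd h2).sub h3).add analyticAt_const)

theorem wormChartInv_analyticAt {y : ℂ × ℂ} (h1 : 1 + y.1 ∈ slitPlane)
    (h2 : y.2 + y.1 + 1 / 2 ≠ 0) : AnalyticAt ℂ wormChartInv y := by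
  have h3 : AnalyticAt ℂ (fun y : ℂ × ℂ => 1 + y.1) y := analyticAt_const.add analyticAt_fst
  exact (h3.cpow analyticAt_const h1).prod
    ((h3.pow 2).div ((analyticAt_snd.add analyticAt_fst).add analyticAt_const) h2)

theorem cpow_cpow_neg_inv {z c : ℂ} (h1 : -Real.pi < (log z * c).im)
    (h2 : (log z * c).im ≤ Real.pi) (hc : c ≠ 0) : (z ^ c) ^ c⁻¹ = z := by
  rw [← cpow_mul _ h1 h2, mul_inv_cancel₀ hc, cpow_one]

/-- Principal powers compose while the imaginary part of c log z stays between -π and π. This holds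
near z = 1, where log z is small. -/
theorem cpow_I_cpow_neg_I : ∀ᶠ z in 𝓝 (1 : ℂ), (z ^ I) ^ (-I) = z ∧ (z ^ (-I)) ^ I = z := by
  have h : ∀ c : ℂ, ∀ᶠ z in 𝓝 (1 : ℂ), -Real.pi < (log z * c).im ∧ (log z * c).im < Real.pi := by
    intro c
    have hc : ContinuousAt (fun z : ℂ => (log z * c).im) 1 :=
      Complex.continuous_im.continuousAt.comp
        ((continuousAt_clog (by simp)).mul continuousAt_const)
    have h0 : (log 1 * c).im = 0 := by simp
    exact (continuousAt_const.eventually_lt hc (by rw [h0]; linarith [Real.pi_pos])).and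
      (hc.eventually_lt continuousAt_const (by rw [h0]; exact Real.pi_pos))
  filter_upwards [h I, h (-I)] with z h1 h2
  constructor
  · have := cpow_cpow_neg_inv h1.1 h1.2.le I_ne_zero
    rwa [inv_I] at this
  · have := cpow_cpow_neg_inv h2.1 h2.2.le (neg_ne_zero.2 I_ne_zero)
    rwa [inv_neg, inv_I, neg_neg] at this

theorem wormChart_isLocalBihol :
    IsLocalBihol (frontier unboundedWorm) (1, 2) heisenberg 0 wormChart wormChartInv where
  analyticAt := wormChart_analyticAt (by simp) (by simp)
  analyticAt_inv := wormChartInv_analyticAt (by simp) (by simp)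
  map_point := by
    ext <;> simp [wormChart]
    norm_num
  map_point_inv := by
    ext <;> simp [wormChartInv]
  left_inv := by
    have h1 : ContinuousAt (Prod.fst : ℂ × ℂ → ℂ) (1, 2) := continuousAt_fst
    filter_upwards [h1.tendsto.eventually cpow_I_cpow_neg_I,
      h1.eventually_ne (by simp : ((1, 2) : ℂ × ℂ).1 ≠ 0),
      continuousAt_snd.eventually_ne (by simp : ((1, 2) : ℂ × ℂ).2 ≠ 0)] with x h2 h3 h4
    have h5 : x.1 ^ I ≠ 0 := by simp [cpow_eq_zero_iff, h3]
    ext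
    · simp only [wormChart, wormChartInv, add_sub_cancel]
      exact h2.1
    · simp only [wormChart, wormChartInv, add_sub_cancel]
      have : (x.1 ^ I) ^ 2 / x.2 - x.1 ^ I + 1 / 2 + (x.1 ^ I - 1) + 1 / 2
        = (x.1 ^ I) ^ 2 / x.2 := by ring
      rw [this]
      field_simp
  right_inv := by
    have h1 : Tendsto (fun y : ℂ × ℂ => 1 + y.1) (𝓝 0) (𝓝 1) :=
      (by fun_prop : Continuous fun y : ℂ × ℂ => 1 + y.1).tendsto' _ _ (by simp)
    have h6 : ContinuousAt (fun y : ℂ × ℂ => y.2 + y.1 + 1 / 2) 0 := by fun_prop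
    filter_upwards [h1.eventually cpow_I_cpow_neg_I,
      h1.eventually (continuousAt_id.eventually_ne one_ne_zero),
      h6.eventually_ne (by simp : (0 : ℂ × ℂ).2 + (0 : ℂ × ℂ).1 + 1 / 2 ≠ 0)] with y h2 h3 h4
    simp only [id] at h3
    ext
    · simp only [wormChart, wormChartInv, h2.2]
      ring
    · simp only [wormChart, wormChartInv, h2.2]
      field_simp
      ring
  mem_iff := by
    filter_upwards [continuousAt_fst.eventually_ne (by simp : ((1, 2) : ℂ × ℂ).1 ≠ 0),
      continuousAt_snd.eventually_ne (by simp : ((1, 2) : ℂ × ℂ).2 ≠ 0)] with x h3 h4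
    exact wormChart_mem_heisenberg h3 h4

/-! ### The isotropies of the boundary of the worm -/

/-- The numerator of the base of the first component of `wormMap`. -/
noncomputable def wormN (a : ℂ) (r : ℝ) (s w : ℂ) : ℂ :=
  w * (1 + conj a * (s - 1)) - (a * conj a / 2 + I * r) * (w * (2 * s - 1) - 2 * s ^ 2) / 2

/-- The denominator of the base of the first component of `wormMap`. -/
noncomputable def wormD (l a : ℂ) (r : ℝ) (s w : ℂ) : ℂ :=
  wormN a r s w + l * (w * (s - 1) - a * (w * (2 * s - 1) - 2 * s ^ 2) / 2)

/-- The second factor of the denominator of the second component of `wormMap`. -/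
noncomputable def wormE (l a : ℂ) (r : ℝ) (s w : ℂ) : ℂ :=
  2 * wormD l a r s w - wormN a r s w - l * conj l * (w * (2 * s - 1) - 2 * s ^ 2)

/-- The isotropies of the boundary of the worm at `(1, 2)`. -/
noncomputable def wormMap (l a : ℂ) (r : ℝ) (x : ℂ × ℂ) : ℂ × ℂ :=
  ((wormN a r (x.1 ^ I) x.2 / wormD l a r (x.1 ^ I) x.2) ^ I,
    2 * wormD l a r (x.1 ^ I) x.2 ^ 2 /
      (wormN a r (x.1 ^ I) x.2 * wormE l a r (x.1 ^ I) x.2))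

/-- This explains `wormN`, `wormD` and `wormE`: in the image point, the Heisenberg denominator is
N/w, 1 + Z is D/N, and V + Z + 1/2 is E/(2N). -/
theorem wormMap_eventuallyEq (l a : ℂ) (r : ℝ) :
    wormMap l a r =ᶠ[𝓝 (1, 2)] wormChartInv ∘ heisMap l a r ∘ wormChart := by
  have hB := wormChart_isLocalBihol
  have h1 : ContinuousAt (fun y : ℂ × ℂ => 1 + y.1) 0 := by fun_prop
  have h1' : ∀ᶠ y : ℂ × ℂ in 𝓝 0, 1 + y.1 ∈ slitPlane :=
    h1.eventually_mem (isOpen_slitPlane.mem_nhds (by simp))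
  have h2 : ∀ᶠ y : ℂ × ℂ in 𝓝 0, y.2 + y.1 + 1 / 2 ≠ 0 := by
    have h6 : ContinuousAt (fun y : ℂ × ℂ => y.2 + y.1 + 1 / 2) 0 := by fun_prop
    exact h6.eventually_ne (by simp : (0 : ℂ × ℂ).2 + (0 : ℂ × ℂ).1 + 1 / 2 ≠ 0)
  filter_upwards [((heisMap_tendsto l a r).comp hB.tendsto).eventually (h1'.and h2),
    hB.tendsto.eventually (heisDenom_eventually_ne a r),
    continuousAt_snd.eventually_ne (by simp : ((1, 2) : ℂ × ℂ).2 ≠ 0)] with x ⟨h3, h4⟩ h5 hw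
  set s : ℂ := x.1 ^ I with hs
  have eδ : heisDenom a r (wormChart x) = wormN a r s x.2 / x.2 := by
    simp only [heisDenom, wormChart, wormN, ← hs]
    field_simp
    ring
  have hN : wormN a r s x.2 ≠ 0 := by
    intro h
    rw [eδ, h, zero_div] at h5
    exact h5 rfl
  have e1 : 1 + (heisMap l a r (wormChart x)).1 = wormD l a r s x.2 / wormN a r s x.2 := by
    have : (heisMap l a r (wormChart x)).1
      = l * ((wormChart x).1 + a * (wormChart x).2) / (wormN a r s x.2 / x.2) := by
      rw [← eδ]; rfl
    rw [this]
    simp only [wormChart, wormD, ← hs]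
    field_simp
    ring
  have e2 : (heisMap l a r (wormChart x)).2
      = -(l * conj l * (x.2 * (2 * s - 1) - 2 * s ^ 2)) / (2 * wormN a r s x.2) := by
    have : (heisMap l a r (wormChart x)).2
      = l * conj l * (wormChart x).2 / (wormN a r s x.2 / x.2) := by
      rw [← eδ]; rfl
    rw [this]
    simp only [wormChart, ← hs]
    field_simp
    ring
  have e3 : (heisMap l a r (wormChart x)).2 + (heisMap l a r (wormChart x)).1 + 1 / 2
      = wormE l a r s x.2 / (2 * wormN a r s x.2) := by
    have : (heisMap l a r (wormChart x)).2 + (heisMap l a r (wormChart x)).1 + 1 / 2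
      = (heisMap l a r (wormChart x)).2 + (1 + (heisMap l a r (wormChart x)).1) - 1 / 2 := by ring
    rw [this, e1, e2, wormE]
    field_simp
    ring
  simp only [Function.comp_apply] at h3 h4
  simp only [Function.comp_apply, wormMap, wormChartInv, ← hs, e3]
  rw [e1] at h3 ⊢
  -- Off the branch cut, (D/N)^(-i) may be rewritten as (N/D)^i.
  have harg : (wormD l a r s x.2 / wormN a r s x.2).arg ≠ Real.pi :=
    (mem_slitPlane_iff_arg.1 h3).1
  ext
  · rw [cpow_neg, ← inv_cpow _ _ harg, inv_div]
  · have hE : wormE l a r s x.2 ≠ 0 := by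
      intro h
      rw [e3, h, zero_div] at h4
      exact h4 rfl
    field_simp

theorem wormMap_isotropy {l : ℂ} (hl : l ≠ 0) (a : ℂ) (r : ℝ) :
    IsLocalIsotropy (frontier unboundedWorm) (1, 2) (wormMap l a r) := by
  have h := wormChart_isLocalBihol.symm.conj_isotropy (heisMap_isotropy hl a r)
  have he := wormMap_eventuallyEq l a r
  refine ⟨h.analyticAt.congr he.symm, ?_, ?_, ?_⟩
  · rw [he.self_of_nhds, h.map_point]
  · filter_upwards [he, h.map_mem] with x h1 h2 h3
    rw [h1]
    exact h2 h3
  · rw [he.fderiv_eq]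
    exact h.det_ne_zero

theorem IsLocalIsotropy.eq_wormMap {F : ℂ × ℂ → ℂ × ℂ}
    (hF : IsLocalIsotropy (frontier unboundedWorm) (1, 2) F) :
    ∃ (l a : ℂ) (r : ℝ), l ≠ 0 ∧ F =ᶠ[𝓝 (1, 2)] wormMap l a r := by
  have hB := wormChart_isLocalBihol
  obtain ⟨l, a, r, hl, h⟩ := (hB.conj_isotropy hF).eq_heisMap
  refine ⟨l, a, r, hl, EventuallyEq.trans ?_ (wormMap_eventuallyEq l a r).symm⟩
  filter_upwards [hB.tendsto.eventually h, hB.left_inv, hF.tendsto.eventually hB.left_inv]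
    with x h1 h2 h3
  simp only [Function.comp_apply, h2] at h1 ⊢
  rw [← h1, h3]

theorem wormMap_comp (l₁ a₁ l₂ a₂ : ℂ) (r₁ r₂ : ℝ) :
    wormMap l₂ a₂ r₂ ∘ wormMap l₁ a₁ r₁ =ᶠ[𝓝 (1, 2)]
      wormMap (l₂ * l₁) (a₁ + a₂ * conj l₁) (mulR l₁ a₁ a₂ r₁ r₂) := by
  have hB := wormChart_isLocalBihol
  have ht : Tendsto (heisMap l₁ a₁ r₁ ∘ wormChart) (𝓝 (1, 2)) (𝓝 0) :=
    (heisMap_tendsto l₁ a₁ r₁).comp hB.tendsto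
  have ht' : Tendsto (wormChartInv ∘ heisMap l₁ a₁ r₁ ∘ wormChart) (𝓝 (1, 2)) (𝓝 (1, 2)) :=
    hB.tendsto_inv.comp ht
  filter_upwards [wormMap_eventuallyEq l₁ a₁ r₁, ht'.eventually (wormMap_eventuallyEq l₂ a₂ r₂),
    ht.eventually hB.right_inv, hB.tendsto.eventually (heisMap_comp l₁ a₁ l₂ a₂ r₁ r₂),
    wormMap_eventuallyEq (l₂ * l₁) (a₁ + a₂ * conj l₁) (mulR l₁ a₁ a₂ r₁ r₂)]
    with x h1 h2 h3 h4 h5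
  simp only [Function.comp_apply] at h1 h2 h3 h4 h5 ⊢
  rw [h1, h2, h3, h4, h5]

theorem wormMap_one_zero_zero : wormMap 1 0 0 =ᶠ[𝓝 (1, 2)] id := by
  refine (wormMap_eventuallyEq 1 0 0).trans ?_
  rw [heisMap_one_zero_zero]
  exact wormChart_isLocalBihol.left_inv

/-! ### Jets of the isotropies -/

/-- The second derivative `g_ww(1,2)` of the second component of `F = (f, g)`. -/
noncomputable def dgww (F : ℂ × ℂ → ℂ × ℂ) : ℂ := deriv (deriv fun w => (F (1, w)).2) 2

theorem tendsto_slice_fst {p : ℂ × ℂ} : Tendsto (fun z : ℂ => (z, p.2)) (𝓝 p.1) (𝓝 p) :=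
  (by fun_prop : Continuous fun z : ℂ => (z, p.2)).tendsto' _ _ rfl

theorem tendsto_slice_snd {p : ℂ × ℂ} : Tendsto (fun w : ℂ => (p.1, w)) (𝓝 p.2) (𝓝 p) :=
  (by fun_prop : Continuous fun w : ℂ => (p.1, w)).tendsto' _ _ rfl

theorem dfz_congr {F G : ℂ × ℂ → ℂ × ℂ} (h : F =ᶠ[𝓝 (1, 2)] G) : dfz F = dfz G := by
  refine EventuallyEq.deriv_eq ?_
  filter_upwards [(tendsto_slice_fst (p := (1, 2))).eventually h] with z hz
  rw [hz]

theorem dfw_congr {F G : ℂ × ℂ → ℂ × ℂ} (h : F =ᶠ[𝓝 (1, 2)] G) : dfw F = dfw G := by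
  refine EventuallyEq.deriv_eq ?_
  filter_upwards [(tendsto_slice_snd (p := (1, 2))).eventually h] with z hz
  rw [hz]

theorem dgww_congr {F G : ℂ × ℂ → ℂ × ℂ} (h : F =ᶠ[𝓝 (1, 2)] G) : dgww F = dgww G := by
  refine EventuallyEq.deriv_eq (EventuallyEq.deriv ?_)
  filter_upwards [(tendsto_slice_snd (p := (1, 2))).eventually h] with z hz
  rw [hz]

theorem hasDerivAt_cpow_I {u : ℂ → ℂ} {u' t : ℂ} (hu : HasDerivAt u u' t) (h1 : u t = 1) :
    HasDerivAt (fun t => u t ^ I) (I * u') t := by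
  have := hu.cpow_const (c := I) (by rw [h1]; simp)
  simpa [h1] using this

theorem dfz_wormMap (l a : ℂ) (r : ℝ) : dfz (wormMap l a r) = l := by
  have hs : HasDerivAt (fun z : ℂ => z ^ I) I 1 := by
    simpa using hasDerivAt_cpow_I (hasDerivAt_id (1 : ℂ)) rfl
  have hs1 : (1 : ℂ) ^ I = 1 := one_cpow I
  have hT : HasDerivAt (fun z : ℂ => 2 * (2 * z ^ I - 1) - 2 * (z ^ I) ^ 2) 0 1 := by
    have h := (((hs.const_mul 2).sub_const 1).const_mul 2).sub ((hs.pow 2).const_mul 2)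
    refine h.congr_deriv ?_
    simp only [hs1]
    ring
  have hN : HasDerivAt (fun z : ℂ => wormN a r (z ^ I) 2) (2 * (conj a * I)) 1 := by
    have h := ((((hs.sub_const 1).const_mul (conj a)).const_add 1).const_mul 2).sub
      ((hT.const_mul (a * conj a / 2 + I * r)).div_const 2)
    refine h.congr_deriv ?_
    ring
  have hD : HasDerivAt (fun z : ℂ => wormD l a r (z ^ I) 2) (2 * (conj a * I) + l * (2 * I)) 1 := by
    have h := hN.add (((((hs.sub_const 1).const_mul 2)).sub
      ((hT.const_mul a).div_const 2)).const_mul l)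
    refine h.congr_deriv ?_
    ring
  have hN1 : wormN a r ((1 : ℂ) ^ I) 2 = 2 := by rw [hs1, wormN]; ring
  have hD1 : wormD l a r ((1 : ℂ) ^ I) 2 = 2 := by rw [wormD, hN1, hs1]; ring
  have h := hasDerivAt_cpow_I (hN.div hD (by rw [hD1]; exact two_ne_zero))
    (by simp only [Pi.div_apply, hN1, hD1]; norm_num)
  refine h.deriv.trans ?_
  rw [hN1, hD1]
  linear_combination (-l) * I_sq

theorem dfw_wormMap (l a : ℂ) (r : ℝ) : dfw (wormMap l a r) = I * (l * a) / 4 := by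
  have hs1 : (1 : ℂ) ^ I = 1 := one_cpow I
  have hw := hasDerivAt_id (2 : ℂ)
  have hT : HasDerivAt (fun w : ℂ => w * (2 * (1 : ℂ) ^ I - 1) - 2 * ((1 : ℂ) ^ I) ^ 2) 1 2 := by
    have h := (hw.mul_const (2 * (1 : ℂ) ^ I - 1)).sub_const (2 * ((1 : ℂ) ^ I) ^ 2)
    refine h.congr_deriv ?_
    simp only [hs1]
    ring
  have hN : HasDerivAt (fun w : ℂ => wormN a r ((1 : ℂ) ^ I) w)
      (1 - (a * conj a / 2 + I * r) / 2) 2 := by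
    have h := (hw.mul_const (1 + conj a * ((1 : ℂ) ^ I - 1))).sub
      ((hT.const_mul (a * conj a / 2 + I * r)).div_const 2)
    refine h.congr_deriv ?_
    simp only [hs1]
    ring
  have hD : HasDerivAt (fun w : ℂ => wormD l a r ((1 : ℂ) ^ I) w)
      (1 - (a * conj a / 2 + I * r) / 2 - l * a / 2) 2 := by
    have h := hN.add (((hw.mul_const ((1 : ℂ) ^ I - 1)).sub
      ((hT.const_mul a).div_const 2)).const_mul l)
    refine h.congr_deriv ?_
    simp only [hs1]
    ring
  have hN1 : wormN a r ((1 : ℂ) ^ I) 2 = 2 := by rw [hs1, wormN]; ring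
  have hD1 : wormD l a r ((1 : ℂ) ^ I) 2 = 2 := by rw [wormD, hN1, hs1]; ring
  have h := hasDerivAt_cpow_I (hN.div hD (by rw [hD1]; exact two_ne_zero))
    (by simp only [Pi.div_apply, hN1, hD1]; norm_num)
  refine h.deriv.trans ?_
  rw [hN1, hD1]
  ring

/-- On the slice z = 1 one has s = 1, so N, D and E are affine in w with value 2 at w = 2. This is
the computation of g_ww for such a quotient. -/
theorem deriv_deriv_quotient (A B C : ℂ) :
    deriv (deriv fun w : ℂ => 2 * (2 + A * (w - 2)) ^ 2 /
      ((2 + B * (w - 2)) * (2 + C * (w - 2)))) 2 =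
      A ^ 2 - B * C - 2 * A * (B + C) + (B + C) ^ 2 := by
  have hlin : ∀ A w : ℂ, HasDerivAt (fun w : ℂ => 2 + A * (w - 2)) A w := by
    intro A w
    simpa using (((hasDerivAt_id w).sub_const 2).const_mul A).const_add 2
  have h1 : (deriv fun w : ℂ => 2 * (2 + A * (w - 2)) ^ 2 /
      ((2 + B * (w - 2)) * (2 + C * (w - 2)))) =ᶠ[𝓝 2] fun w =>
      (2 * (2 * (2 + A * (w - 2)) * A) * ((2 + B * (w - 2)) * (2 + C * (w - 2)))
        - 2 * (2 + A * (w - 2)) ^ 2 * (B * (2 + C * (w - 2)) + (2 + B * (w - 2)) * C))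
        / ((2 + B * (w - 2)) * (2 + C * (w - 2))) ^ 2 := by
    have hc : ∀ᶠ w : ℂ in 𝓝 2, (2 + B * (w - 2)) * (2 + C * (w - 2)) ≠ 0 := by
      have : ContinuousAt (fun w : ℂ => (2 + B * (w - 2)) * (2 + C * (w - 2))) 2 := by fun_prop
      exact this.eventually_ne (by simp)
    filter_upwards [hc] with w hw
    have h := (((hlin A w).pow 2).const_mul 2).div ((hlin B w).mul (hlin C w)) hw
    refine h.deriv.trans ?_
    simp
  rw [h1.deriv_eq]
  have hQR := (hlin B 2).mul (hlin C 2)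
  have h := (((((hlin A 2).const_mul 2).mul_const A).const_mul 2).mul hQR).sub
    ((((hlin A 2).pow 2).const_mul 2).mul
      (((hlin C 2).const_mul B).add ((hlin B 2).mul_const C)))
  have h' := h.div (hQR.pow 2) (by simp)
  refine h'.deriv.trans ?_
  simp
  ring

/-- The first derivatives of f do not see r. Here r appears with the nonzero coefficient 2i|l|², so
g_ww supplies the missing parameter. -/
theorem dgww_wormMap (l a : ℂ) (r : ℝ) : 4 * dgww (wormMap l a r) =
    2 * (l * conj l) * (a * conj a / 2 + I * r) - 4 * (l * conj l) + 4 * (l * conj l) * (l * a)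
      + 4 * (l * conj l) ^ 2 + (l * a) ^ 2 := by
  have hs1 : (1 : ℂ) ^ I = 1 := one_cpow I
  set b : ℂ := a * conj a / 2 + I * r with hb
  have h : (fun w => (wormMap l a r (1, w)).2) = fun w : ℂ =>
      2 * (2 + (1 - b / 2 - l * a / 2) * (w - 2)) ^ 2 /
        ((2 + (1 - b / 2) * (w - 2)) *
          (2 + (1 - b / 2 - l * a - l * conj l) * (w - 2))) := by
    funext w
    simp only [wormMap, hs1]
    have e1 : wormN a r 1 w = 2 + (1 - b / 2) * (w - 2) := by
      rw [wormN, ← hb]; ring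
    have e2 : wormD l a r 1 w = 2 + (1 - b / 2 - l * a / 2) * (w - 2) := by
      rw [wormD, e1]; ring
    have e3 : wormE l a r 1 w = 2 + (1 - b / 2 - l * a - l * conj l) * (w - 2) := by
      rw [wormE, e2, e1]; ring
    rw [e1, e2, e3]
  rw [dgww, h, deriv_deriv_quotient]
  ring

/-! ### The explicit families -/

/-- Both components are homogeneous of degree 0 in (N, D, E), so the displayed families need to
match `wormMap` only up to a constant. -/
theorem pair_eq_of_common_factor {c n d e N D E : ℂ} (hc : c ≠ 0) (hN : N = c * n)
    (hD : D = c * d) (hE : E = c * e) :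
    (((N / D) ^ I, 2 * D ^ 2 / (N * E)) : ℂ × ℂ) = ((n / d) ^ I, 2 * d ^ 2 / (n * e)) := by
  subst hN hD hE
  rw [mul_div_mul_left _ _ hc]
  congr 1
  have h : 2 * (c * d) ^ 2 / (c * n * (c * e)) = (c ^ 2 * (2 * d ^ 2)) / (c ^ 2 * (n * e)) := by
    congr 1 <;> ring
  rw [h, mul_div_mul_left _ _ (pow_ne_zero 2 hc)]

theorem ofReal_add_I_mul_ne_zero {x y : ℝ} (h : x ≠ 0 ∨ y ≠ 0) : (x + I * y : ℂ) ≠ 0 := by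
  intro h0
  have h1 := congrArg re h0
  have h2 := congrArg im h0
  simp at h1 h2
  rcases h with h | h
  · exact h h1
  · exact h h2

theorem conj_ofReal_add_I_mul (x y : ℝ) : conj (x + I * y : ℂ) = x - I * y := by
  simp only [map_add, map_mul, conj_ofReal, conj_I]
  ring

/-- The parameter `a` of the isotropy with `f_z(1,2) = l` and `f_w(1,2) = t`. -/
noncomputable def aParam (l t : ℂ) : ℂ := -4 * I * t / l

theorem aParam_conj (l t : ℂ) : conj (aParam l t) = 4 * I * conj t / conj l := by
  simp only [aParam, map_div₀, map_mul, map_neg, map_ofNat, conj_I]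
  ring

theorem mul_aParam {l : ℂ} (hl : l ≠ 0) (t : ℂ) : l * aParam l t = -4 * I * t :=
  mul_div_cancel_of_imp' (fun h => absurd h hl)

theorem aParam_eq {l a t : ℂ} (hl : l ≠ 0) (h : I * (l * a) / 4 = t) : a = aParam l t := by
  rw [aParam, ← h]
  field_simp
  linear_combination a * I_sq

theorem dfw_aParam {l : ℂ} (hl : l ≠ 0) (t : ℂ) : I * (l * aParam l t) / 4 = t := by
  rw [aParam]
  field_simp
  linear_combination (-t) * I_sq

/-- The common factor is -νq(μ - iν) with q = ξ² + ρ². The value of r is found by matching K with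
iνq(μ - iν)(|a|²/2 + ir)/4 (`hK`); σ, φ, ψ enter through K alone. -/
theorem H₁_eq_wormMap {μ ν ξ ρ : ℝ} (hν : ν ≠ 0) (hq : ξ ≠ 0 ∨ ρ ≠ 0) (σ φ ψ : ℝ) :
    H₁ μ ν ξ ρ σ φ ψ = wormMap (μ + I * ν) (aParam (μ + I * ν) (ξ + I * ρ))
      (-4 * (μ * (ξ ^ 2 + ρ ^ 2) + μ * (ξ * σ + ρ * φ) - ν * (ξ * φ - ρ * σ)
        - (ξ ^ 2 + ρ ^ 2) * (2 * ρ + ψ) + 2 * (ξ ^ 2 + ρ ^ 2) ^ 2 * μ / (μ ^ 2 + ν ^ 2))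
        / (ν * (ξ ^ 2 + ρ ^ 2))) := by
  have hq0 : ξ ^ 2 + ρ ^ 2 ≠ 0 := by
    rcases hq with h | h <;> positivity
  have hm0 : μ ^ 2 + ν ^ 2 ≠ 0 := by positivity
  have hl : (μ + I * ν : ℂ) ≠ 0 := ofReal_add_I_mul_ne_zero (Or.inr hν)
  have hlc : (μ - I * ν : ℂ) ≠ 0 := by
    rw [← conj_ofReal_add_I_mul]; exact (map_ne_zero _).2 hl
  have hνc : (ν : ℂ) ≠ 0 := by exact_mod_cast hν
  have hqc : (ξ ^ 2 + ρ ^ 2 : ℂ) ≠ 0 := by exact_mod_cast hq0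
  have hm : (μ + I * ν : ℂ) * (μ - I * ν) = μ ^ 2 + ν ^ 2 := by
    linear_combination (-(ν : ℂ) ^ 2) * I_sq
  have hmc : (μ ^ 2 + ν ^ 2 : ℂ) ≠ 0 := by exact_mod_cast hm0
  have hqf : (ξ + I * ρ : ℂ) * (ξ - I * ρ) = ξ ^ 2 + ρ ^ 2 := by
    linear_combination (-(ρ : ℂ) ^ 2) * I_sq
  have ha : aParam (μ + I * ν) (ξ + I * ρ)
      = -4 * I * (ξ + I * ρ) * (μ - I * ν) / (μ ^ 2 + ν ^ 2) := by
    rw [aParam, ← hm]; field_simp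
  have hac : conj (aParam (μ + I * ν) (ξ + I * ρ)) = 4 * I * (ξ - I * ρ) / (μ - I * ν) := by
    rw [aParam_conj, conj_ofReal_add_I_mul, conj_ofReal_add_I_mul]
  have haa : aParam (μ + I * ν) (ξ + I * ρ) * conj (aParam (μ + I * ν) (ξ + I * ρ))
      = 16 * (ξ ^ 2 + ρ ^ 2) / (μ ^ 2 + ν ^ 2) := by
    rw [hac, ha, ← hqf]
    field_simp
    linear_combination (-16 * (ξ : ℂ) ^ 2 + 16 * I ^ 2 * (ρ : ℂ) ^ 2) * I_sq
  set r : ℝ := -4 * (μ * (ξ ^ 2 + ρ ^ 2) + μ * (ξ * σ + ρ * φ) - ν * (ξ * φ - ρ * σ)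
        - (ξ ^ 2 + ρ ^ 2) * (2 * ρ + ψ) + 2 * (ξ ^ 2 + ρ ^ 2) ^ 2 * μ / (μ ^ 2 + ν ^ 2))
        / (ν * (ξ ^ 2 + ρ ^ 2)) with hr
  set a := aParam (μ + I * ν) (ξ + I * ρ) with hadef
  have hK : K₁ μ ν ξ ρ σ φ ψ
      = I * ν * (ξ ^ 2 + ρ ^ 2) * (μ - I * ν) * (a * conj a / 2 + I * r) / 4 := by
    rw [haa, hr]
    push_cast
    rw [K₁]
    field_simp
    ring_nf
    simp only [I_sq, I_pow_three]
    ring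
  have hla : (μ + I * ν : ℂ) * a = -4 * I * (ξ + I * ρ) := mul_aParam hl _
  have hlac : (μ - I * ν : ℂ) * conj a = 4 * I * (ξ - I * ρ) := by
    rw [hac]; field_simp
  clear_value a
  have hN : ∀ s w : ℂ, N₁ μ ν ξ ρ σ φ ψ s w
      = -(ν * (ξ ^ 2 + ρ ^ 2) * (μ - I * ν)) * wormN a r s w := by
    intro s w
    rw [N₁, wormN, hK]
    linear_combination (ν * (ξ ^ 2 + ρ ^ 2) * w * (s - 1)) * hlac
      - (ν * (ξ ^ 2 + ρ ^ 2) * (μ - I * ν) * (a * conj a / 2 + I * r)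
        * (w * (2 * s - 1) - 2 * s ^ 2) / 2) * I_sq
  have hD : ∀ s w : ℂ, D₁ μ ν ξ ρ σ φ ψ s w
      = -(ν * (ξ ^ 2 + ρ ^ 2) * (μ - I * ν)) * wormD (μ + I * ν) a r s w := by
    intro s w
    rw [D₁, wormD, hN]
    linear_combination (ν * (ξ ^ 2 + ρ ^ 2) * (s - 1) * w) * hm
      - (ν * (ξ ^ 2 + ρ ^ 2) * (μ - I * ν) * (w * (2 * s - 1) - 2 * s ^ 2) / 2) * hla
  funext x
  refine pair_eq_of_common_factor (c := -(ν * (ξ ^ 2 + ρ ^ 2) * (μ - I * ν))) ?_ (hN _ _)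
    (hD _ _) ?_
  · exact neg_ne_zero.2 (mul_ne_zero (mul_ne_zero hνc hqc) hlc)
  · rw [hN, hD, wormE, conj_ofReal_add_I_mul, hm]
    ring

/-- The first family's factor vanishes at ν = 0. Here the common factor is μ²q, and r is read off
from the coefficient of w(2s - 1) - 2s² in N. -/
theorem H₂_eq_wormMap {μ ξ ρ : ℝ} (hμ : μ ≠ 0) (hq : ξ ≠ 0 ∨ ρ ≠ 0) (σ φ ψ : ℝ) :
    H₂ μ ξ ρ σ φ ψ = wormMap μ (aParam μ (ξ + I * ρ))
      (-4 * (ρ * σ - ξ * φ) / (ξ ^ 2 + ρ ^ 2) - 4 * (ψ - 2 * ξ) / μ) := by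
  have hq0 : ξ ^ 2 + ρ ^ 2 ≠ 0 := by
    rcases hq with h | h <;> positivity
  have hμc : (μ : ℂ) ≠ 0 := by exact_mod_cast hμ
  have hqc : (ξ ^ 2 + ρ ^ 2 : ℂ) ≠ 0 := by exact_mod_cast hq0
  have hac : conj (aParam μ (ξ + I * ρ)) = 4 * I * (ξ - I * ρ) / μ := by
    rw [aParam_conj, conj_ofReal_add_I_mul, conj_ofReal]
  have hqf : (ξ + I * ρ : ℂ) * (ξ - I * ρ) = ξ ^ 2 + ρ ^ 2 := by
    linear_combination (-(ρ : ℂ) ^ 2) * I_sq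
  have haa : aParam μ (ξ + I * ρ) * conj (aParam μ (ξ + I * ρ))
      = 16 * (ξ ^ 2 + ρ ^ 2) / μ ^ 2 := by
    rw [hac, aParam, ← hqf]
    field_simp
    linear_combination (-16 * (ξ : ℂ) ^ 2 + 16 * I ^ 2 * (ρ : ℂ) ^ 2) * I_sq
  set r : ℝ := -4 * (ρ * σ - ξ * φ) / (ξ ^ 2 + ρ ^ 2) - 4 * (ψ - 2 * ξ) / μ with hr
  have hN : ∀ s w : ℂ, N₂ μ ξ ρ σ φ ψ s w
      = μ ^ 2 * (ξ ^ 2 + ρ ^ 2) * wormN (aParam μ (ξ + I * ρ)) r s w := by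
    intro s w
    rw [N₂, wormN, haa, hac, hr]
    push_cast
    field_simp
    ring_nf
    simp only [I_sq]
    ring
  have hD : ∀ s w : ℂ, D₂ μ ξ ρ σ φ ψ s w
      = μ ^ 2 * (ξ ^ 2 + ρ ^ 2) * wormD μ (aParam μ (ξ + I * ρ)) r s w := by
    intro s w
    rw [wormD, mul_add, ← hN, aParam, N₂, D₂]
    field_simp
    ring_nf
    simp only [I_sq]
    ring
  funext x
  refine pair_eq_of_common_factor (c := μ ^ 2 * (ξ ^ 2 + ρ ^ 2)) ?_ (hN _ _) (hD _ _) ?_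
  · exact mul_ne_zero (pow_ne_zero 2 hμc) hqc
  · rw [wormE, mul_sub, mul_sub, mul_left_comm _ (2 : ℂ), ← hN, ← hD, conj_ofReal, N₂, D₂, E₂]
    ring_nf
    simp only [I_sq]
    ring

theorem H₃_eq_wormMap {ν : ℝ} (hν : ν ≠ 0) (μ ψ : ℝ) :
    H₃ μ ν ψ = wormMap (μ + I * ν) 0 (-4 * ψ / ν) := by
  have hνc : (ν : ℂ) ≠ 0 := by exact_mod_cast hν
  funext x
  have h := pair_eq_of_common_factor (c := -(I * ν))
    (n := wormN 0 (-4 * ψ / ν) (x.1 ^ I) x.2) (d := wormD (μ + I * ν) 0 (-4 * ψ / ν) (x.1 ^ I) x.2)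
    (e := wormE (μ + I * ν) 0 (-4 * ψ / ν) (x.1 ^ I) x.2)
    (neg_ne_zero.2 (mul_ne_zero I_ne_zero hνc)) rfl rfl rfl
  rw [wormMap, ← h, H₃]
  have hN : -(I * ν) * wormN 0 (-4 * ψ / ν) (x.1 ^ I) x.2
      = x.2 * (4 * ψ * x.1 ^ I - I * ν - 2 * ψ) - 4 * ψ * (x.1 ^ I) ^ 2 := by
    rw [wormN]
    push_cast
    simp only [map_zero]
    field_simp
    ring_nf
    simp only [I_sq]
    ring
  have hD : -(I * ν) * wormD (μ + I * ν) 0 (-4 * ψ / ν) (x.1 ^ I) x.2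
      = x.2 * (4 * ψ * x.1 ^ I + ν ^ 2 * (x.1 ^ I - 1) - I * ν * (1 + μ * (x.1 ^ I - 1)) - 2 * ψ)
        - 4 * ψ * (x.1 ^ I) ^ 2 := by
    rw [wormD, mul_add, hN]
    ring_nf
    simp only [I_sq]
    ring
  -- The displayed third factor differs from the rescaled one by -i, which accounts for the constant
  -- -2i in g₃. The sign changes in N and D are undone at the end.
  have hE : -(I * ν) * wormE (μ + I * ν) 0 (-4 * ψ / ν) (x.1 ^ I) x.2
      = -I * (x.2 * (-((μ - 1) * ν * (2 * μ * x.1 ^ I - μ + 1)) - ν ^ 3 * (2 * x.1 ^ I - 1)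
            + 2 * I * ν ^ 2 * (x.1 ^ I - 1) + 2 * I * ψ * (2 * x.1 ^ I - 1))
          + 2 * (x.1 ^ I) ^ 2 * (μ ^ 2 * ν + ν ^ 3 - 2 * I * ψ)) := by
    rw [wormE, mul_sub, mul_sub, mul_left_comm _ (2 : ℂ), hN, hD, conj_ofReal_add_I_mul]
    ring_nf
    simp only [I_sq, I_pow_three]
    ring
  rw [hN, hD, hE]
  congr 1
  set s := x.1 ^ I
  set N := x.2 * (4 * ψ * s - I * ν - 2 * ψ) - 4 * ψ * s ^ 2 with hNd
  set D := x.2 * (4 * ψ * s + ν ^ 2 * (s - 1) - I * ν * (1 + μ * (s - 1)) - 2 * ψ)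
        - 4 * ψ * s ^ 2 with hDd
  set G := x.2 * (-((μ - 1) * ν * (2 * μ * s - μ + 1)) - ν ^ 3 * (2 * s - 1)
            + 2 * I * ν ^ 2 * (s - 1) + 2 * I * ψ * (2 * s - 1))
          + 2 * s ^ 2 * (μ ^ 2 * ν + ν ^ 3 - 2 * I * ψ)
  have e1 : x.2 * (-(4 * ψ * s) - ν ^ 2 * (s - 1) + I * ν * (1 + μ * (s - 1)) + 2 * ψ)
          + 4 * ψ * s ^ 2 = -D := by rw [hDd]; ring
  have e2 : x.2 * (-(4 * ψ * s) + I * ν + 2 * ψ) + 4 * ψ * s ^ 2 = -N := by rw [hNd]; ring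
  rw [e1, e2]
  have e3 : N * (-I * G) = I * (-N * G) := by ring
  have e4 : 2 * D ^ 2 = I * -(2 * I * (-D) ^ 2) := by linear_combination (2 * D ^ 2) * I_sq
  rw [e3, e4, mul_div_mul_left _ _ I_ne_zero, neg_div]

theorem H₄_eq_wormMap {μ : ℝ} (hμ : μ ≠ 0) (ψ : ℝ) : H₄ μ ψ = wormMap μ 0 (4 * ψ / μ) := by
  have hμc : (μ : ℂ) ≠ 0 := by exact_mod_cast hμ
  funext x
  have h := pair_eq_of_common_factor (c := -(μ : ℂ))
    (n := wormN 0 (4 * ψ / μ) (x.1 ^ I) x.2) (d := wormD μ 0 (4 * ψ / μ) (x.1 ^ I) x.2)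
    (e := wormE μ 0 (4 * ψ / μ) (x.1 ^ I) x.2) (neg_ne_zero.2 hμc) rfl rfl rfl
  rw [wormMap, ← h, H₄]
  have hN : -(μ : ℂ) * wormN 0 (4 * ψ / μ) (x.1 ^ I) x.2
      = x.2 * (2 * I * ψ * (2 * x.1 ^ I - 1) - μ) - 4 * I * ψ * (x.1 ^ I) ^ 2 := by
    rw [wormN]
    push_cast
    simp only [map_zero]
    field_simp
    ring
  have hD : -(μ : ℂ) * wormD μ 0 (4 * ψ / μ) (x.1 ^ I) x.2
      = x.2 * (2 * I * ψ * (2 * x.1 ^ I - 1) - μ ^ 2 * (x.1 ^ I - 1) - μ)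
        - 4 * I * ψ * (x.1 ^ I) ^ 2 := by
    rw [wormD, mul_add, hN]
    ring
  have hE : -(μ : ℂ) * wormE μ 0 (4 * ψ / μ) (x.1 ^ I) x.2
      = -(x.2 * (-(2 * I * ψ * (2 * x.1 ^ I - 1)) + μ ^ 2 * (-(2 * (μ - 1) * x.1 ^ I) + μ - 2) + μ)
          + 2 * (x.1 ^ I) ^ 2 * (μ ^ 3 + 2 * I * ψ)) := by
    rw [wormE, mul_sub, mul_sub, mul_left_comm _ (2 : ℂ), hN, hD, conj_ofReal]
    ring
  rw [hN, hD, hE]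
  congr 1
  congr 1 <;> ring

theorem IsLocalIsotropy.congr {M : Set (ℂ × ℂ)} {p : ℂ × ℂ} {F G : ℂ × ℂ → ℂ × ℂ}
    (hG : IsLocalIsotropy M p G) (h : F =ᶠ[𝓝 p] G) : IsLocalIsotropy M p F where
  analyticAt := hG.analyticAt.congr h.symm
  map_point := by rw [h.self_of_nhds, hG.map_point]
  map_mem := by
    filter_upwards [h, hG.map_mem] with x h1 h2 h3
    rw [h1]
    exact h2 h3
  det_ne_zero := by
    rw [h.fderiv_eq]
    exact hG.det_ne_zero

/-- The isotropies with prescribed first derivatives are parametrised by a real number. -/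
theorem isotropy_with_derivatives_iff {F : ℂ × ℂ → ℂ × ℂ} {l : ℂ} (hl : l ≠ 0) (t : ℂ) :
    (IsLocalIsotropy (frontier unboundedWorm) (1, 2) F ∧ dfz F = l ∧ dfw F = t) ↔
      ∃ r : ℝ, F =ᶠ[𝓝 (1, 2)] wormMap l (aParam l t) r := by
  constructor
  · rintro ⟨hF, h1, h2⟩
    obtain ⟨l', a, r, hl', h⟩ := hF.eq_wormMap
    have e1 : l' = l := by rw [← h1, dfz_congr h, dfz_wormMap]
    subst e1
    have e2 : a = aParam l' t := aParam_eq hl' (by rw [← h2, dfw_congr h, dfw_wormMap])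
    subst e2
    exact ⟨r, h⟩
  · rintro ⟨r, h⟩
    exact ⟨(wormMap_isotropy hl _ r).congr h, by rw [dfz_congr h, dfz_wormMap],
      by rw [dfw_congr h, dfw_wormMap, dfw_aParam hl]⟩

/-- Only surjectivity of the reparametrisation is needed, so three real parameters may describe a
one-parameter set redundantly. -/
theorem exists_eventuallyEq_congr {ι : Type*} {p : ℂ × ℂ} {F : ℂ × ℂ → ℂ × ℂ}
    {A : ℝ → ℂ × ℂ → ℂ × ℂ} {B : ι → ℂ × ℂ → ℂ × ℂ} {k : ι → ℝ} (hk : Function.Surjective k)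
    (h : ∀ i, B i = A (k i)) : (∃ r, F =ᶠ[𝓝 p] A r) ↔ ∃ i, F =ᶠ[𝓝 p] B i := by
  constructor
  · rintro ⟨r, hr⟩
    obtain ⟨i, rfl⟩ := hk r
    exact ⟨i, by rwa [h i]⟩
  · rintro ⟨i, hi⟩
    exact ⟨k i, by rwa [← h i]⟩

theorem isotropy_iff_H₁ {F : ℂ × ℂ → ℂ × ℂ} {μ ν ξ ρ : ℝ} (hν : ν ≠ 0) (hq : ξ ≠ 0 ∨ ρ ≠ 0) :
    (IsLocalIsotropy (frontier unboundedWorm) (1, 2) F ∧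
      dfz F = μ + I * ν ∧ dfw F = ξ + I * ρ) ↔
        ∃ σ φ ψ : ℝ, F =ᶠ[𝓝 (1, 2)] H₁ μ ν ξ ρ σ φ ψ := by
  rw [isotropy_with_derivatives_iff (ofReal_add_I_mul_ne_zero (Or.inr hν))]
  have hq0 : ξ ^ 2 + ρ ^ 2 ≠ 0 := by
    rcases hq with h | h <;> positivity
  rw [exists_eventuallyEq_congr (ι := ℝ × ℝ × ℝ) (B := fun i => H₁ μ ν ξ ρ i.1 i.2.1 i.2.2) ?_
    (fun i => H₁_eq_wormMap hν hq i.1 i.2.1 i.2.2)]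
  · simp only [Prod.exists]
  · intro r
    -- As r is affine in ψ with nonzero slope, one may take σ = φ = 0 and solve for ψ.
    refine ⟨(0, 0, (μ * (ξ ^ 2 + ρ ^ 2) - (ξ ^ 2 + ρ ^ 2) * (2 * ρ)
      + 2 * (ξ ^ 2 + ρ ^ 2) ^ 2 * μ / (μ ^ 2 + ν ^ 2) + r * (ν * (ξ ^ 2 + ρ ^ 2)) / 4)
      / (ξ ^ 2 + ρ ^ 2)), ?_⟩
    have hm0 : μ ^ 2 + ν ^ 2 ≠ 0 := by positivity
    field_simp
    ring

theorem isotropy_iff_H₂ {F : ℂ × ℂ → ℂ × ℂ} {μ ξ ρ : ℝ} (hμ : μ ≠ 0) (hq : ξ ≠ 0 ∨ ρ ≠ 0) :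
    (IsLocalIsotropy (frontier unboundedWorm) (1, 2) F ∧
      dfz F = μ ∧ dfw F = ξ + I * ρ) ↔
        ∃ σ φ ψ : ℝ, F =ᶠ[𝓝 (1, 2)] H₂ μ ξ ρ σ φ ψ := by
  rw [isotropy_with_derivatives_iff (by exact_mod_cast hμ)]
  rw [exists_eventuallyEq_congr (ι := ℝ × ℝ × ℝ) (B := fun i => H₂ μ ξ ρ i.1 i.2.1 i.2.2) ?_
    (fun i => H₂_eq_wormMap hμ hq i.1 i.2.1 i.2.2)]
  · simp only [Prod.exists]
  · intro r
    refine ⟨(0, 0, 2 * ξ - r * μ / 4), ?_⟩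
    field_simp
    ring

theorem isotropy_iff_H₃ {F : ℂ × ℂ → ℂ × ℂ} {μ ν : ℝ} (hν : ν ≠ 0) :
    (IsLocalIsotropy (frontier unboundedWorm) (1, 2) F ∧ dfz F = μ + I * ν ∧ dfw F = 0) ↔
        ∃ ψ : ℝ, F =ᶠ[𝓝 (1, 2)] H₃ μ ν ψ := by
  rw [isotropy_with_derivatives_iff (ofReal_add_I_mul_ne_zero (Or.inr hν))]
  refine exists_eventuallyEq_congr (k := fun ψ => -4 * ψ / ν) (fun r => ⟨-(r * ν) / 4, ?_⟩)
    fun ψ => ?_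
  · field_simp
  · rw [H₃_eq_wormMap hν, aParam]
    simp

theorem isotropy_iff_H₄ {F : ℂ × ℂ → ℂ × ℂ} {μ : ℝ} (hμ : μ ≠ 0) :
    (IsLocalIsotropy (frontier unboundedWorm) (1, 2) F ∧ dfz F = μ ∧ dfw F = 0) ↔
        ∃ ψ : ℝ, F =ᶠ[𝓝 (1, 2)] H₄ μ ψ := by
  rw [isotropy_with_derivatives_iff (by exact_mod_cast hμ)]
  refine exists_eventuallyEq_congr (k := fun ψ => 4 * ψ / μ) (fun r => ⟨r * μ / 4, ?_⟩)
    fun ψ => ?_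
  · field_simp
  · rw [H₄_eq_wormMap hμ, aParam]
    simp

theorem dfz_ne_zero {F : ℂ × ℂ → ℂ × ℂ}
    (hF : IsLocalIsotropy (frontier unboundedWorm) (1, 2) F) : dfz F ≠ 0 := by
  obtain ⟨l, a, r, hl, h⟩ := hF.eq_wormMap
  rwa [dfz_congr h, dfz_wormMap]

/-- The parameters `(l, a, r)` of an isotropy, computed from the derivatives `f_z`, `f_w`, `g_ww`
at `(1, 2)`. -/
noncomputable def jetParam (j : ℂ × ℂ × ℂ) : ℂ × ℂ × ℝ :=
  (j.1, aParam j.1 j.2.1,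
    ((4 * j.2.2 - 4 * (j.1 * conj j.1) * (-4 * I * j.2.1) - (-4 * I * j.2.1) ^ 2)
      / (2 * (j.1 * conj j.1))).im)

/-- Once the terms in l a are removed from 4 g_ww and the rest is divided by 2|l|², what remains is
a real number plus ir. -/
theorem jetParam_wormMap {l : ℂ} (hl : l ≠ 0) (a : ℂ) (r : ℝ) :
    jetParam (dfz (wormMap l a r), dfw (wormMap l a r), dgww (wormMap l a r)) = (l, a, r) := by
  have hl' : conj l ≠ 0 := (map_ne_zero _).2 hl
  have h1 : -4 * I * (I * (l * a) / 4) = l * a := by linear_combination (-(l * a)) * I_sq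
  have h2 : (2 * (l * conj l) * (a * conj a / 2 + I * r) - 4 * (l * conj l)
      + 4 * (l * conj l) * (l * a) + 4 * (l * conj l) ^ 2 + (l * a) ^ 2
      - 4 * (l * conj l) * (l * a) - (l * a) ^ 2) / (2 * (l * conj l))
      = a * conj a / 2 - 2 + 2 * (l * conj l) + I * r := by
    field_simp
    ring
  rw [jetParam]
  simp only [dfz_wormMap, dfw_wormMap, dgww_wormMap, h1, h2]
  refine Prod.ext rfl (Prod.ext (aParam_eq hl rfl).symm ?_)
  rw [Complex.mul_conj, Complex.mul_conj]
  have h3 : (normSq a / 2 - 2 + 2 * normSq l + I * r : ℂ)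
    = ((normSq a / 2 - 2 + 2 * normSq l : ℝ) : ℂ) + r * I := by
    push_cast
    ring
  simp only [h3]
  simp

theorem jetParam_continuousAt {j : ℂ × ℂ × ℂ} (hj : j.1 ≠ 0) : ContinuousAt jetParam j := by
  have hj' : conj j.1 ≠ 0 := (map_ne_zero _).2 hj
  have c : ContinuousAt (fun j : ℂ × ℂ × ℂ => conj j.1) j :=
    Complex.continuous_conj.continuousAt.comp continuousAt_fst
  unfold jetParam aParam
  refine ContinuousAt.prodMk continuousAt_fst (ContinuousAt.prodMk ?_ ?_)
  · exact ContinuousAt.div (by fun_prop) continuousAt_fst hj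
  · refine Complex.continuous_im.continuousAt.comp (ContinuousAt.div (by fun_prop) (by fun_prop) ?_)
    exact mul_ne_zero two_ne_zero (mul_ne_zero hj hj')

/-! ### Continuity of jets in the inductive limit topology -/

section

variable {p : ℂ × ℂ} {r : ℝ}

/-- The function underlying an element of `HolOn p r`. -/
def HolOn.toFun (F : HolOn p r) : ℂ × ℂ → ℂ × ℂ :=
  UniformOnFun.toFun {Metric.closedBall p r} F.1

theorem HolOn.analyticOnNhd (F : HolOn p r) :
    AnalyticOnNhd ℂ F.toFun (Metric.closedBall p r) := F.2

theorem HolOn.tendstoUniformlyOn (F : HolOn p r) :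
    TendstoUniformlyOn (fun G : HolOn p r => G.toFun) F.toFun (𝓝 F) (Metric.closedBall p r) := by
  have h : Continuous (fun G : HolOn p r => G.1) := continuous_subtype_val
  exact UniformOnFun.tendsto_iff_tendstoUniformlyOn.1 h.continuousAt.tendsto _ rfl

theorem slice_fst_mem_closedBall {z : ℂ} (hz : z ∈ Metric.ball p.1 r) :
    (z, p.2) ∈ Metric.closedBall p r := by
  rw [Metric.mem_closedBall, Prod.dist_eq]
  have := (Metric.mem_ball.1 hz).le
  exact max_le this (by simpa using dist_nonneg.trans this)

theorem slice_snd_mem_closedBall {w : ℂ} (hw : w ∈ Metric.ball p.2 r) :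
    (p.1, w) ∈ Metric.closedBall p r := by
  rw [Metric.mem_closedBall, Prod.dist_eq]
  have := (Metric.mem_ball.1 hw).le
  exact max_le (by simpa using dist_nonneg.trans this) this

theorem HolOn.tendstoLocallyUniformlyOn_slice {L : ℂ × ℂ → ℂ} (hL : UniformContinuous L)
    {γ : ℂ → ℂ × ℂ} {U : Set ℂ} (hγ : ∀ z ∈ U, γ z ∈ Metric.closedBall p r) (F : HolOn p r) :
    TendstoLocallyUniformlyOn (fun (G : HolOn p r) z => L (G.toFun (γ z)))
      (fun z => L (F.toFun (γ z))) (𝓝 F) U := by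
  have h1 := (hL.comp_tendstoUniformlyOn F.tendstoUniformlyOn).comp γ
  exact (h1.mono hγ).tendstoLocallyUniformlyOn

theorem HolOn.differentiableOn_slice {L : ℂ × ℂ → ℂ} (hL : Differentiable ℂ L)
    {γ : ℂ → ℂ × ℂ} (hγd : Differentiable ℂ γ) {U : Set ℂ}
    (hγ : ∀ z ∈ U, γ z ∈ Metric.closedBall p r) (F : HolOn p r) :
    DifferentiableOn ℂ (fun z => L (F.toFun (γ z))) U := fun z hz =>
  ((hL _).comp z (((F.analyticOnNhd _ (hγ z hz)).differentiableAt).comp z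
    (hγd z))).differentiableWithinAt

end

/-- The triple of derivatives `f_z`, `f_w`, `g_ww` at `(1, 2)` of a germ. -/
noncomputable def germJet (F : (𝓝 ((1, 2) : ℂ × ℂ)).Germ (ℂ × ℂ)) : ℂ × ℂ × ℂ :=
  F.liftOn (fun F => (dfz F, dfw F, dgww F)) fun _ _ h => by
    simp only [dfz_congr h, dfw_congr h, dgww_congr h]

/-- Continuity out of an inductive limit is checked on each polydisc. There Weierstrass' theorem
passes uniform convergence to the derivatives of the one-variable slices. -/
theorem germJet_continuous : @Continuous _ _ (holGermTopology (1, 2)) _ germJet := by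
  refine continuous_iSup_dom.2 fun r => continuous_coinduced_dom.2 ?_
  obtain ⟨r, hr⟩ := r
  change Continuous fun F : HolOn ((1, 2) : ℂ × ℂ) r => (dfz F.toFun, dfw F.toFun, dgww F.toFun)
  have m1 : (1 : ℂ) ∈ Metric.ball (1 : ℂ) r := Metric.mem_ball_self hr
  have m2 : (2 : ℂ) ∈ Metric.ball (2 : ℂ) r := Metric.mem_ball_self hr
  have g1 : ∀ z ∈ Metric.ball (1 : ℂ) r, (z, (2 : ℂ)) ∈ Metric.closedBall ((1, 2) : ℂ × ℂ) r :=
    fun z hz => slice_fst_mem_closedBall (p := (1, 2)) hz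
  have g2 : ∀ w ∈ Metric.ball (2 : ℂ) r, ((1 : ℂ), w) ∈ Metric.closedBall ((1, 2) : ℂ × ℂ) r :=
    fun w hw => slice_snd_mem_closedBall (p := (1, 2)) hw
  refine continuous_iff_continuousAt.2 fun F => ?_
  refine ContinuousAt.prodMk ?_ (ContinuousAt.prodMk ?_ ?_)
  · exact ((F.tendstoLocallyUniformlyOn_slice uniformContinuous_fst g1).deriv
      (Eventually.of_forall fun G => G.differentiableOn_slice differentiable_fst (by fun_prop) g1)
      Metric.isOpen_ball).tendsto_at m1
  · exact ((F.tendstoLocallyUniformlyOn_slice uniformContinuous_fst g2).deriv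
      (Eventually.of_forall fun G => G.differentiableOn_slice differentiable_fst (by fun_prop) g2)
      Metric.isOpen_ball).tendsto_at m2
  · exact (((F.tendstoLocallyUniformlyOn_slice uniformContinuous_snd g2).deriv
      (Eventually.of_forall fun G => G.differentiableOn_slice differentiable_snd (by fun_prop) g2)
      Metric.isOpen_ball).deriv (Eventually.of_forall fun G =>
        (G.differentiableOn_slice differentiable_snd (by fun_prop) g2).deriv Metric.isOpen_ball)
      Metric.isOpen_ball).tendsto_at m2

/-! ### Continuous dependence on the parameters -/

/-- A family of maps depending continuously on a parameter, jointly with the point, and analytic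
near `p`, gives a continuous family of germs. -/
theorem continuous_germ_of_family {P : Type*} [TopologicalSpace P] {p : ℂ × ℂ}
    {f : P → ℂ × ℂ → ℂ × ℂ}
    (h : ∀ q, ∀ᶠ y : P × (ℂ × ℂ) in 𝓝 (q, p),
      ContinuousAt f.uncurry y ∧ AnalyticAt ℂ (f y.1) y.2) :
    @Continuous _ _ _ (holGermTopology p) fun q => (f q : (𝓝 p).Germ (ℂ × ℂ)) := by
  let := holGermTopology p
  refine continuous_iff_continuousAt.2 fun q => ?_
  have h1 := h q
  rw [nhds_prod_eq] at h1
  obtain ⟨A, hA, B, hB, hAB⟩ := eventually_prod_iff.1 h1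
  obtain ⟨A', hA', hA'o, hqA'⟩ := eventually_nhds_iff.1 hA
  obtain ⟨ε, hε, hB'⟩ := Metric.eventually_nhds_iff_ball.1 hB
  have hρ : 0 < ε / 2 := by positivity
  have hball : ∀ x ∈ Metric.closedBall p (ε / 2), B x := fun x hx =>
    hB' x (Metric.closedBall_subset_ball (by linarith) hx)
  let Ψ : A' → HolOn p (ε / 2) := fun a =>
    ⟨UniformOnFun.ofFun _ (f a), fun x hx => (hAB (hA' a a.2) (hball x hx)).2⟩
  have hΨ : Continuous Ψ := by
    refine Continuous.subtype_mk (continuous_iff_continuousAt.2 fun a => ?_) _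
    refine UniformOnFun.tendsto_iff_tendstoUniformlyOn.2 fun s hs => ?_
    rw [Set.mem_singleton_iff.1 hs]
    have hc : ContinuousOn (fun y : A' × (ℂ × ℂ) => f y.1 y.2)
        (Set.univ ×ˢ Metric.closedBall p (ε / 2)) := by
      intro y hy
      have h2 := (hAB (hA' y.1 y.1.2) (hball y.2 hy.2)).1
      have h3 : Continuous fun y : A' × (ℂ × ℂ) => ((y.1 : P), y.2) := by fun_prop
      exact (ContinuousAt.comp (f := fun y : A' × (ℂ × ℂ) => ((y.1 : P), y.2))
        (g := f.uncurry) (x := y) h2 h3.continuousAt).continuousWithinAt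
    intro u hu
    -- Joint continuity on a compact polydisc gives uniform convergence there as the parameter
    -- varies.
    obtain ⟨v, hv, hv'⟩ := (isCompact_closedBall p (ε / 2)).mem_uniformity_of_prod
      (f := fun (a : A') x => f a x) hc (Set.mem_univ a) (UniformSpace.symm hu)
    rw [nhdsWithin_univ] at hv
    filter_upwards [hv] with b hb x hx
    exact hv' b hb x hx
  have hg : Continuous (HolOn.germ (p := p) (r := ε / 2)) :=
    continuous_iff_coinduced_le.2 (le_iSup (fun r : {r : ℝ // 0 < r} =>
      TopologicalSpace.coinduced (HolOn.germ (p := p) (r := r.1)) inferInstance) ⟨ε / 2, hρ⟩)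
  have hon : ContinuousOn (fun q => (f q : (𝓝 p).Germ (ℂ × ℂ))) A' :=
    continuousOn_iff_continuous_domRestrict.2 (hg.comp hΨ)
  exact hon.continuousAt (hA'o.mem_nhds hqA')

theorem wormMap_germ_continuous :
    @Continuous _ _ _ (holGermTopology (1, 2)) fun q : ℂ × ℂ × ℝ =>
      (wormMap q.1 q.2.1 q.2.2 : (𝓝 ((1, 2) : ℂ × ℂ)).Germ (ℂ × ℂ)) := by
  refine continuous_germ_of_family (f := fun q : ℂ × ℂ × ℝ => wormMap q.1 q.2.1 q.2.2) fun q => ?_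
  have hs : ∀ y : (ℂ × ℂ × ℝ) × (ℂ × ℂ), y.2.1 ∈ slitPlane →
      ContinuousAt (fun y : (ℂ × ℂ × ℝ) × (ℂ × ℂ) => y.2.1 ^ I) y := fun y hy =>
    (continuousAt_fst.comp continuousAt_snd).cpow continuousAt_const hy
  have hN : ∀ y : (ℂ × ℂ × ℝ) × (ℂ × ℂ), y.2.1 ∈ slitPlane →
      ContinuousAt (fun y : (ℂ × ℂ × ℝ) × (ℂ × ℂ) => wormN y.1.2.1 y.1.2.2 (y.2.1 ^ I) y.2.2) y := by
    intro y hy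
    have h1 := hs y hy
    have h2 : ContinuousAt (fun y : (ℂ × ℂ × ℝ) × (ℂ × ℂ) => conj y.1.2.1) y :=
      Complex.continuous_conj.continuousAt.comp (by fun_prop)
    have h3 : ContinuousAt (fun y : (ℂ × ℂ × ℝ) × (ℂ × ℂ) => (y.1.2.2 : ℂ)) y :=
      Complex.continuous_ofReal.continuousAt.comp (by fun_prop)
    unfold wormN
    fun_prop
  have hD : ∀ y : (ℂ × ℂ × ℝ) × (ℂ × ℂ), y.2.1 ∈ slitPlane →
      ContinuousAt (fun y : (ℂ × ℂ × ℝ) × (ℂ × ℂ) =>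
        wormD y.1.1 y.1.2.1 y.1.2.2 (y.2.1 ^ I) y.2.2) y := by
    intro y hy
    have h1 := hs y hy
    have h2 := hN y hy
    unfold wormD
    fun_prop
  have hE : ∀ y : (ℂ × ℂ × ℝ) × (ℂ × ℂ), y.2.1 ∈ slitPlane →
      ContinuousAt (fun y : (ℂ × ℂ × ℝ) × (ℂ × ℂ) =>
        wormE y.1.1 y.1.2.1 y.1.2.2 (y.2.1 ^ I) y.2.2) y := by
    intro y hy
    have h1 := hs y hy
    have h2 := hN y hy
    have h3 := hD y hy
    have h4 : ContinuousAt (fun y : (ℂ × ℂ × ℝ) × (ℂ × ℂ) => conj y.1.1) y :=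
      Complex.continuous_conj.continuousAt.comp (by fun_prop)
    unfold wormE
    fun_prop
  set y₀ : (ℂ × ℂ × ℝ) × (ℂ × ℂ) := (q, (1, 2)) with hy₀
  have hy₀s : y₀.2.1 ∈ slitPlane := by simp [hy₀]
  have hs1 : (1 : ℂ) ^ I = 1 := one_cpow I
  have hN1 : wormN y₀.1.2.1 y₀.1.2.2 (y₀.2.1 ^ I) y₀.2.2 = 2 := by
    simp only [hy₀, hs1, wormN]; ring
  have hD1 : wormD y₀.1.1 y₀.1.2.1 y₀.1.2.2 (y₀.2.1 ^ I) y₀.2.2 = 2 := by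
    rw [wormD, hN1]
    simp only [hy₀, hs1]; ring
  have hE1 : wormE y₀.1.1 y₀.1.2.1 y₀.1.2.2 (y₀.2.1 ^ I) y₀.2.2 = 2 := by
    rw [wormE, hN1, hD1]
    simp only [hy₀, hs1]; ring
  have c1 : ∀ᶠ y : (ℂ × ℂ × ℝ) × (ℂ × ℂ) in 𝓝 y₀, y.2.1 ∈ slitPlane :=
    ContinuousAt.eventually_mem (f := fun y : (ℂ × ℂ × ℝ) × (ℂ × ℂ) => y.2.1) (by fun_prop)
      (isOpen_slitPlane.mem_nhds hy₀s)
  have c2 := (hN y₀ hy₀s).eventually_ne (y := 0) (by rw [hN1]; exact two_ne_zero)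
  have c3 := (hD y₀ hy₀s).eventually_ne (y := 0) (by rw [hD1]; exact two_ne_zero)
  have c4 := (hE y₀ hy₀s).eventually_ne (y := 0) (by rw [hE1]; exact two_ne_zero)
  -- At the base point N/D = 1, so nearby the quotient avoids the branch cut of the power i.
  have c5 := ((hN y₀ hy₀s).div (hD y₀ hy₀s) (by rw [hD1]; exact two_ne_zero)).eventually_mem
    (isOpen_slitPlane.mem_nhds (by rw [Pi.div_apply, hN1, hD1]; simp))
  filter_upwards [c1, c2, c3, c4, c5] with y h1 h2 h3 h4 h5
  refine ⟨?_, ?_⟩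
  · exact (((hN y h1).div (hD y h1) h3).cpow continuousAt_const h5).prodMk
      ((continuousAt_const.mul ((hD y h1).pow 2)).div ((hN y h1).mul (hE y h1))
        (mul_ne_zero h2 h4))
  · have hsan : AnalyticAt ℂ (fun x : ℂ × ℂ => x.1 ^ I) y.2 :=
      analyticAt_fst.cpow analyticAt_const h1
    have hw : AnalyticAt ℂ (fun x : ℂ × ℂ => x.2) y.2 := analyticAt_snd
    have hNan : AnalyticAt ℂ (fun x : ℂ × ℂ => wormN y.1.2.1 y.1.2.2 (x.1 ^ I) x.2) y.2 := by
      unfold wormN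
      fun_prop
    have hDan : AnalyticAt ℂ (fun x : ℂ × ℂ => wormD y.1.1 y.1.2.1 y.1.2.2 (x.1 ^ I) x.2) y.2 := by
      unfold wormD
      fun_prop
    have hEan : AnalyticAt ℂ (fun x : ℂ × ℂ => wormE y.1.1 y.1.2.1 y.1.2.2 (x.1 ^ I) x.2) y.2 := by
      unfold wormE
      fun_prop
    exact ((hNan.div hDan h3).cpow analyticAt_const h5).prod
      ((analyticAt_const.mul (hDan.pow 2)).div (hNan.mul hEan) (mul_ne_zero h2 h4))

/-! ### The Lie group structure -/

/-- A topological monoid with inverses which has an open embedding into a vector space of dimension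
`n` in which multiplication and inversion are smooth is a Lie group of dimension `n`. -/
theorem isRealLieGroupOfDim_of_isOpenEmbedding {G : Type} [mG : Monoid G] [TopologicalSpace G]
    {E : Type*} [NormedAddCommGroup E] [NormedSpace ℝ E] [FiniteDimensional ℝ E] {n : ℕ}
    (hn : Module.finrank ℝ E = n) {e : G → E} (he : IsOpenEmbedding e) {inv : G → G}
    (hinv : ∀ x, inv x * x = 1) {m : E × E → E} (hm : ContDiff ℝ ∞ m)
    (hme : ∀ x y, e (x * y) = m (e x, e y)) {i : E → E} (hi : ContDiffOn ℝ ∞ i (Set.range e))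
    (hie : ∀ x, e (inv x) = i (e x)) : IsRealLieGroupOfDim G n := by
  have hT2 : T2Space G := he.toIsEmbedding.t2Space
  have : ProperSpace E := FiniteDimensional.proper_real E
  have : SecondCountableTopology E := inferInstance
  have hSC : SecondCountableTopology G := he.toIsEmbedding.secondCountableTopology
  let L : E ≃L[ℝ] EuclideanSpace ℝ (Fin n) :=
    ContinuousLinearEquiv.ofFinrankEq (by rw [hn]; simp)
  let e' : G → EuclideanSpace ℝ (Fin n) := fun x => L (e x)
  have he' : IsOpenEmbedding e' := L.toHomeomorph.isOpenEmbedding.comp he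
  let grp : Group G := { mG with inv := inv, inv_mul_cancel := hinv }
  -- The embedding is a single global chart, so there are no transition maps to check. Smoothness of
  -- the operations reduces to smoothness of `m` and of `i` on the image.
  let cs : ChartedSpace (EuclideanSpace ℝ (Fin n)) G := he'.singletonChartedSpace
  have : Nonempty G := ⟨1⟩
  refine ⟨hT2, hSC, grp, cs, rfl, ?_⟩
  have hman : IsManifold 𝓘(ℝ, EuclideanSpace ℝ (Fin n)) ∞ G := he'.isManifold_singleton
  have hsm : ContMDiff 𝓘(ℝ, EuclideanSpace ℝ (Fin n)) 𝓘(ℝ, EuclideanSpace ℝ (Fin n)) ∞ e' :=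
    contMDiff_isOpenEmbedding he'
  refine { hman with contMDiff_mul := ?_, contMDiff_inv := ?_ }
  · refine ContMDiff.of_comp_isOpenEmbedding he' ?_
    have h1 : ContDiff ℝ ∞ fun z : EuclideanSpace ℝ (Fin n) × EuclideanSpace ℝ (Fin n) =>
        L (m (L.symm z.1, L.symm z.2)) := L.contDiff.comp (hm.comp
          ((L.symm.contDiff.comp contDiff_fst).prodMk (L.symm.contDiff.comp contDiff_snd)))
    have h2 := h1.contMDiff.comp
      ((hsm.comp contMDiff_fst).prodMk_space (hsm.comp contMDiff_snd) :
        ContMDiff (𝓘(ℝ, EuclideanSpace ℝ (Fin n)).prod 𝓘(ℝ, EuclideanSpace ℝ (Fin n)))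
          𝓘(ℝ, EuclideanSpace ℝ (Fin n) × EuclideanSpace ℝ (Fin n)) ∞
          fun z : G × G => (e' z.1, e' z.2))
    refine h2.congr fun z => ?_
    change L (e (z.1 * z.2)) = L (m (L.symm (L (e z.1)), L.symm (L (e z.2))))
    rw [L.symm_apply_apply, L.symm_apply_apply, hme]
  · refine ContMDiff.of_comp_isOpenEmbedding he' ?_
    have h1 : ContDiffOn ℝ ∞ (fun z : EuclideanSpace ℝ (Fin n) => L (i (L.symm z)))
        (Set.range e') := by
      refine L.contDiff.comp_contDiffOn (hi.comp L.symm.contDiff.contDiffOn ?_)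
      rintro _ ⟨x, rfl⟩
      exact ⟨x, (L.symm_apply_apply _).symm⟩
    have h2 := h1.contMDiffOn.comp_contMDiff hsm fun x => Set.mem_range_self x
    refine h2.congr fun x => ?_
    change L (e (inv x)) = L (i (L.symm (L (e x))))
    rw [L.symm_apply_apply, hie]

/-- The group of isotropy germs of the boundary of the worm. -/
abbrev WormGerms : Type := IsotropyGerms (frontier unboundedWorm) (1, 2)

/-- The isotropy germ with given parameters. -/
noncomputable def wormGerm (q : {q : ℂ × ℂ × ℝ // q.1 ≠ 0}) : WormGerms :=
  Quotient.mk _ ⟨wormMap q.1.1 q.1.2.1 q.1.2.2, wormMap_isotropy q.2 _ _⟩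

/-- The parameters of an isotropy germ. -/
noncomputable def wormGermParam (g : WormGerms) : ℂ × ℂ × ℝ := jetParam (germJet g.toGerm)

theorem wormGermParam_wormGerm (q : {q : ℂ × ℂ × ℝ // q.1 ≠ 0}) :
    wormGermParam (wormGerm q) = q.1 :=
  jetParam_wormMap q.2 _ _

theorem wormGerm_surjective : Function.Surjective wormGerm := by
  rintro ⟨F⟩
  obtain ⟨l, a, r, hl, h⟩ := F.2.eq_wormMap
  exact ⟨⟨(l, a, r), hl⟩, Quotient.sound h.symm⟩

theorem wormGermParam_fst_ne_zero (g : WormGerms) : (wormGermParam g).1 ≠ 0 := by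
  obtain ⟨q, rfl⟩ := wormGerm_surjective g
  rw [wormGermParam_wormGerm]
  exact q.2

theorem wormGerm_wormGermParam (g : WormGerms) :
    wormGerm ⟨wormGermParam g, wormGermParam_fst_ne_zero g⟩ = g := by
  obtain ⟨q, rfl⟩ := wormGerm_surjective g
  congr 1
  exact Subtype.ext (wormGermParam_wormGerm q)

theorem wormGerm_continuous : Continuous wormGerm := by
  let := holGermTopology (1, 2)
  exact continuous_induced_rng.2 (wormMap_germ_continuous.comp continuous_subtype_val)

theorem wormGermParam_continuous : Continuous wormGermParam := by
  let := holGermTopology (1, 2)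
  refine continuous_iff_continuousAt.2 fun g => ?_
  have h1 : Continuous fun g : WormGerms => germJet g.toGerm :=
    germJet_continuous.comp continuous_induced_dom
  exact ContinuousAt.comp (f := fun g : WormGerms => germJet g.toGerm) (g := jetParam)
    (jetParam_continuousAt (wormGermParam_fst_ne_zero g)) h1.continuousAt

/-- The parametrisation of the isotropy germs is a homeomorphism. -/
noncomputable def wormGermHomeomorph : WormGerms ≃ₜ {q : ℂ × ℂ × ℝ // q.1 ≠ 0} where
  toFun g := ⟨wormGermParam g, wormGermParam_fst_ne_zero g⟩
  invFun := wormGerm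
  left_inv := wormGerm_wormGermParam
  right_inv q := Subtype.ext (wormGermParam_wormGerm q)
  continuous_toFun := wormGermParam_continuous.subtype_mk _
  continuous_invFun := wormGerm_continuous

theorem wormGermParam_isOpenEmbedding : IsOpenEmbedding wormGermParam := by
  have h : IsOpen {q : ℂ × ℂ × ℝ | q.1 ≠ 0} := isOpen_ne_fun continuous_fst continuous_const
  exact h.isOpenEmbedding_subtypeVal.comp wormGermHomeomorph.isOpenEmbedding

/-- Multiplication of isotropy germs in parameters. -/
noncomputable def paramMul (z : (ℂ × ℂ × ℝ) × (ℂ × ℂ × ℝ)) : ℂ × ℂ × ℝ :=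
  (z.1.1 * z.2.1, z.2.2.1 + z.1.2.1 * conj z.2.1, mulR z.2.1 z.2.2.1 z.1.2.1 z.2.2.2 z.1.2.2)

/-- Inversion of isotropy germs in parameters. -/
noncomputable def paramInv (q : ℂ × ℂ × ℝ) : ℂ × ℂ × ℝ :=
  (q.1⁻¹, -q.2.1 / conj q.1, -q.2.2 / (q.1 * conj q.1).re)

/-- The left factor is applied last, so its parameters play the role of (l₂, a₂, r₂) in
`wormMap_comp`. -/
theorem wormGerm_mul (q q' : {q : ℂ × ℂ × ℝ // q.1 ≠ 0}) :
    wormGerm q * wormGerm q' = wormGerm ⟨paramMul (q.1, q'.1), mul_ne_zero q.2 q'.2⟩ :=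
  Quotient.sound (wormMap_comp _ _ _ _ _ _)

theorem wormGermParam_mul (g g' : WormGerms) :
    wormGermParam (g * g') = paramMul (wormGermParam g, wormGermParam g') := by
  obtain ⟨q, rfl⟩ := wormGerm_surjective g
  obtain ⟨q', rfl⟩ := wormGerm_surjective g'
  rw [wormGerm_mul, wormGermParam_wormGerm, wormGermParam_wormGerm, wormGermParam_wormGerm]

theorem paramInv_mul {q : ℂ × ℂ × ℝ} (hq : q.1 ≠ 0) : paramMul (paramInv q, q) = (1, 0, 0) := by
  obtain ⟨l, a, r⟩ := q
  simp only at hq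
  obtain ⟨h1, h2, h3⟩ := heisInv_param hq a r
  simp only [paramMul, paramInv]
  rw [h1, h2, h3]

theorem wormGerm_one : wormGerm ⟨(1, 0, 0), one_ne_zero⟩ = 1 :=
  Quotient.sound wormMap_one_zero_zero

theorem conj_contDiff : ContDiff ℝ ∞ (fun z : ℂ => conj z) := conjCLE.contDiff

theorem paramMul_contDiff : ContDiff ℝ ∞ paramMul := by
  have hc {E : Type} [NormedAddCommGroup E] [NormedSpace ℝ E] {f : E → ℂ} (hf : ContDiff ℝ ∞ f) :
    ContDiff ℝ ∞ fun x => conj (f x) := conj_contDiff.comp hf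
  have hre {E : Type} [NormedAddCommGroup E] [NormedSpace ℝ E] {f : E → ℂ} (hf : ContDiff ℝ ∞ f) :
    ContDiff ℝ ∞ fun x => (f x).re := reCLM.contDiff.comp hf
  have him {E : Type} [NormedAddCommGroup E] [NormedSpace ℝ E] {f : E → ℂ} (hf : ContDiff ℝ ∞ f) :
    ContDiff ℝ ∞ fun x => (f x).im := imCLM.contDiff.comp hf
  have l₁ : ContDiff ℝ ∞ fun z : (ℂ × ℂ × ℝ) × (ℂ × ℂ × ℝ) => z.2.1 := by fun_prop
  have a₁ : ContDiff ℝ ∞ fun z : (ℂ × ℂ × ℝ) × (ℂ × ℂ × ℝ) => z.2.2.1 := by fun_prop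
  have r₁ : ContDiff ℝ ∞ fun z : (ℂ × ℂ × ℝ) × (ℂ × ℂ × ℝ) => z.2.2.2 := by fun_prop
  have l₂ : ContDiff ℝ ∞ fun z : (ℂ × ℂ × ℝ) × (ℂ × ℂ × ℝ) => z.1.1 := by fun_prop
  have a₂ : ContDiff ℝ ∞ fun z : (ℂ × ℂ × ℝ) × (ℂ × ℂ × ℝ) => z.1.2.1 := by fun_prop
  have r₂ : ContDiff ℝ ∞ fun z : (ℂ × ℂ × ℝ) × (ℂ × ℂ × ℝ) => z.1.2.2 := by fun_prop
  exact (l₂.mul l₁).prodMk ((a₁.add (a₂.mul (hc l₁))).prodMk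
    ((r₁.add (r₂.mul (hre (l₁.mul (hc l₁))))).add (him (((hc a₂).mul l₁).mul a₁))))

theorem paramInv_contDiffOn : ContDiffOn ℝ ∞ paramInv {q | q.1 ≠ 0} := by
  have l : ContDiffOn ℝ ∞ (fun q : ℂ × ℂ × ℝ => q.1) {q | q.1 ≠ 0} := contDiff_fst.contDiffOn
  have a : ContDiffOn ℝ ∞ (fun q : ℂ × ℂ × ℝ => q.2.1) {q | q.1 ≠ 0} :=
    (by fun_prop : ContDiff ℝ ∞ fun q : ℂ × ℂ × ℝ => q.2.1).contDiffOn
  have r : ContDiffOn ℝ ∞ (fun q : ℂ × ℂ × ℝ => q.2.2) {q | q.1 ≠ 0} :=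
    (by fun_prop : ContDiff ℝ ∞ fun q : ℂ × ℂ × ℝ => q.2.2).contDiffOn
  have lc : ContDiffOn ℝ ∞ (fun q : ℂ × ℂ × ℝ => conj q.1) {q | q.1 ≠ 0} :=
    conj_contDiff.comp_contDiffOn l
  have lc0 : ∀ q ∈ {q : ℂ × ℂ × ℝ | q.1 ≠ 0}, conj q.1 ≠ 0 := fun q hq => (map_ne_zero _).2 hq
  have m : ContDiffOn ℝ ∞ (fun q : ℂ × ℂ × ℝ => (q.1 * conj q.1).re) {q | q.1 ≠ 0} :=
    reCLM.contDiff.comp_contDiffOn (l.mul lc)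
  refine (l.inv fun q hq => hq).prodMk ((?_ : ContDiffOn ℝ ∞ (fun q : ℂ × ℂ × ℝ =>
    -q.2.1 / conj q.1) _).prodMk ?_)
  · simp only [div_eq_mul_inv]
    exact a.neg.mul (lc.inv lc0)
  · refine r.neg.div m fun q hq => ?_
    rw [Complex.mul_conj, ofReal_re]
    exact (map_ne_zero _).2 hq

/-- Inverses exist because every germ has parameters with l ≠ 0, and `paramInv` gives the parameters
of a left inverse. The dimension is 2 + 2 + 1. -/
theorem wormGerms_isRealLieGroup : IsRealLieGroupOfDim WormGerms 5 := by
  have hinv (g : WormGerms) : (paramInv (wormGermParam g)).1 ≠ 0 :=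
    inv_ne_zero (wormGermParam_fst_ne_zero g)
  refine isRealLieGroupOfDim_of_isOpenEmbedding (E := ℂ × ℂ × ℝ) ?_ wormGermParam_isOpenEmbedding
    (inv := fun g => wormGerm ⟨paramInv (wormGermParam g), hinv g⟩) ?_ paramMul_contDiff
    wormGermParam_mul (i := paramInv) ?_ fun g => wormGermParam_wormGerm _
  · simp
  · intro g
    obtain ⟨q, hq⟩ : ∃ q, wormGerm q = g := wormGerm_surjective g
    have h1 : wormGermParam g = q.1 := by rw [← hq, wormGermParam_wormGerm]
    conv_lhs => rw [← wormGerm_wormGermParam g]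
    simp only [wormGermParam_wormGerm]
    rw [wormGerm_mul, ← wormGerm_one]
    congr 1
    exact Subtype.ext (paramInv_mul (wormGermParam_fst_ne_zero g))
  · refine paramInv_contDiffOn.mono ?_
    rintro _ ⟨g, rfl⟩
    exact wormGermParam_fst_ne_zero g

theorem mainTheorem3 :
    IsRealLieGroupOfDim (IsotropyGerms (frontier unboundedWorm) (1, 2)) 5 ∧
    ∀ F : ℂ × ℂ → ℂ × ℂ,
      (IsLocalIsotropy (frontier unboundedWorm) (1, 2) F → dfz F ≠ 0) ∧
      (∀ μ ν ξ ρ : ℝ, ν ≠ 0 → (ξ ≠ 0 ∨ ρ ≠ 0) →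
        ((IsLocalIsotropy (frontier unboundedWorm) (1, 2) F ∧
            dfz F = μ + I * ν ∧ dfw F = ξ + I * ρ) ↔
          ∃ σ φ ψ : ℝ, F =ᶠ[𝓝 (1, 2)] H₁ μ ν ξ ρ σ φ ψ)) ∧
      (∀ μ ξ ρ : ℝ, μ ≠ 0 → (ξ ≠ 0 ∨ ρ ≠ 0) →
        ((IsLocalIsotropy (frontier unboundedWorm) (1, 2) F ∧
            dfz F = μ ∧ dfw F = ξ + I * ρ) ↔
          ∃ σ φ ψ : ℝ, F =ᶠ[𝓝 (1, 2)] H₂ μ ξ ρ σ φ ψ)) ∧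
      (∀ μ ν : ℝ, ν ≠ 0 →
        ((IsLocalIsotropy (frontier unboundedWorm) (1, 2) F ∧
            dfz F = μ + I * ν ∧ dfw F = 0) ↔
          ∃ ψ : ℝ, F =ᶠ[𝓝 (1, 2)] H₃ μ ν ψ)) ∧
      (∀ μ : ℝ, μ ≠ 0 →
        ((IsLocalIsotropy (frontier unboundedWorm) (1, 2) F ∧
            dfz F = μ ∧ dfw F = 0) ↔
          ∃ ψ : ℝ, F =ᶠ[𝓝 (1, 2)] H₄ μ ψ)) :=
  ⟨wormGerms_isRealLieGroup, fun _ => ⟨dfz_ne_zero, fun _ _ _ _ => isotropy_iff_H₁,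
    fun _ _ _ => isotropy_iff_H₂, fun _ _ => isotropy_iff_H₃, fun _ => isotropy_iff_H₄⟩⟩
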